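/- Let $\Gamma$ be an abelian group and let $A$ and $B$ be $\Gamma$-graded rings (associative with identity). Modules are unitary right modules. $\operatorname{Mod-}A$ is the category of right $A$-modules. $\operatorname{Gr-}A$ is the category of $\Gamma$-graded right $A$-modules $M=\bigoplus_{\gamma\in\Gamma}M_\gamma$ (so $M_\gamma A_\alpha\subseteq M_{\gamma+\alpha}$), with the $A$-linear maps $f$ satisfying $f(M_\gamma)\subseteq N_\gamma$ for all $\gamma$ as morphisms. $U$ denotes the forgetful functors $\operatorname{Gr-}A\to\operatorname{Mod-}A$ and $\operatorname{Gr-}B\to\operatorname{Mod-}B$, and $\mathcal T_\alpha$ the shift functor $M\mapsto M(\alpha)$, where $M(\alpha)_\gamma=M_{\gamma+\alpha}$. All functors are additive. We use the following notions. * A functor $\phi:\operatorname{Gr-}A\to\operatorname{Gr-}B$ is *graded* if $\phi\mathcal T_\alpha=\mathcal T_\alpha\phi$ (equality of functors) for all $\alpha\in\Gamma$. It is a *graded equivalence* if it is graded and there is a graded functor $\psi:\operatorname{Gr-}B\to\operatorname{Gr-}A$ with $\psi\phi\cong 1$ and $\phi\psi\cong 1$ (these natural isomorphisms need not be compatible with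 the shifts). * A graded functor $\phi:\operatorname{Gr-}A\to\operatorname{Gr-}B$ is an *associated graded functor* of $\phi':\operatorname{Mod-}A\to\operatorname{Mod-}B$ if $U\phi=\phi'U$ (equality of functors). A functor $\phi':\operatorname{Mod-}A\to\operatorname{Mod-}B$ is a *graded equivalence* if it is an equivalence of categories that has an associated graded functor. * A *graded progenerator* is a finitely generated graded right $A$-module $P$ that is a projective object of $\operatorname{Gr-}A$ and a graded generator: for every nonzero morphism $f:M\to N$ in $\operatorname{Gr-}A$ there are $\alpha\in\Gamma$ and a morphism $g:P(\alpha)\to M$ in $\operatorname{Gr-}A$ with $fg\neq0$. Its endomorphism ring $\operatorname{End}_A(P)$ is graded by $\operatorname{End}_A(P)_\gamma=\{f : f(P_\beta)\subseteq P_{\beta+\gamma}\text{ for all }\beta\in\Gamma\}$. * For $n\ge 1$ and $\overline\delta=(\delta_1,\dots,\delta_n)\in\Gamma^n$, $\mathbb M_n(A)(\overline\delta)$ is the ring of $n\times n$ matrices over $A$, in which a matrix is homogeneous of degree $\gamma$ when its $(i,j)$ entry lies in $A_{\gamma+\delta_j-\delta_i}$ for all $i,j$. An idempotent $e$ of a ring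 $R$ is *full* if $ReR=R$. For a homogeneous idempotent $e$ of a graded ring $R$, the ring $eRe$ (with identity $e$) carries the grading $(eRe)_\gamma=eRe\cap R_\gamma$. * $\cong_{\mathrm{gr}}$ denotes a ring isomorphism that preserves the homogeneous components. A *graded $A$-$B$-bimodule* is an $A$-$B$-bimodule $Q=\bigoplus_\gamma Q_\gamma$ with $A_\alpha Q_\gamma B_\beta\subseteq Q_{\alpha+\gamma+\beta}$; for $M$ in $\operatorname{Gr-}A$ the $B$-module $M\otimes_AQ$ is graded, its component of degree $\gamma$ being generated by the $m\otimes q$ with $m\in M_i$, $q\in Q_j$, $i+j=\gamma$. **Theorem.** (a) The following are equivalent: 1. there is a graded equivalence $\operatorname{Mod-}A\to\operatorname{Mod-}B$; 2. there is a graded equivalence $\operatorname{Gr-}A\to\operatorname{Gr-}B$; 3. $B\cong_{\mathrm{gr}}\operatorname{End}_A(P)$ for a graded progenerator $P$ in $\operatorname{Gr-}A$; 4. $B\cong_{\mathrm{gr}}e\,\mathbb M_n(A)(\overline\delta)\,e$ for some $n\ge1$, some $\overline\delta\in\Gamma^n$ and some full homogeneous idempotent $e\in\mathbb M_n(A)(\overline\delta)$.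 (b) Let $\phi:\operatorname{Gr-}A\to\operatorname{Gr-}B$ be a graded equivalence. Then there is a graded equivalence $\phi':\operatorname{Mod-}A\to\operatorname{Mod-}B$ with an associated graded functor isomorphic to $\phi$. More precisely, there is a graded $A$-$B$-bimodule $Q$ such that $\phi\cong-\otimes_AQ$ as functors $\operatorname{Gr-}A\to\operatorname{Gr-}B$, the functor $-\otimes_AQ:\operatorname{Mod-}A\to\operatorname{Mod-}B$ is a graded equivalence, and the graded functor $-\otimes_AQ:\operatorname{Gr-}A\to\operatorname{Gr-}B$ is an associated graded functor of it; that is, $U\circ(-\otimes_AQ)=(-\otimes_AQ)\circ U$. -/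

import Mathlib

open CategoryTheory MulOpposite
open scoped TensorProduct

universe u w

namespace GradedMorita

/-! ### Internal direct sums of subgroups -/

section Internal

variable {Γ : Type*} [DecidableEq Γ] {T : Type*} [AddCommGroup T]

theorem isInternal_iff (G : Γ → AddSubgroup T) :
    DirectSum.IsInternal G ↔ iSupIndep G ∧ ∀ x, x ∈ ⨆ γ, G γ := by
  have hr : (DirectSum.coeAddMonoidHom G).range = ⨆ γ, G γ := by
    refine le_antisymm ?_ (iSup_le fun γ x hx => ⟨DirectSum.of (fun i => G i) γ ⟨x, hx⟩, by simp⟩)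
    rintro _ ⟨y, rfl⟩
    induction y using DirectSum.induction_on with
    | zero => simp
    | of i y => simpa using AddSubgroup.mem_iSup_of_mem i y.2
    | add y z hy hz => rw [map_add]; exact add_mem hy hz
  constructor
  · intro h
    refine ⟨h.addSubgroup_iSupIndep, fun x => ?_⟩
    rw [← hr]
    exact h.2 x
  · rintro ⟨h, h'⟩
    refine ⟨h.dfinsuppSumAddHom_injective, fun x => ?_⟩
    have := h' x
    rwa [← hr] at this

/-- Translating the indices preserves direct sum decompositions. -/
theorem isInternal_shift [AddGroup Γ] {G : Γ → AddSubgroup T}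
    (h : DirectSum.IsInternal G) (α : Γ) : DirectSum.IsInternal fun γ => G (γ + α) := by
  rw [isInternal_iff] at h ⊢
  refine ⟨h.1.comp (add_left_injective α), fun x => ?_⟩
  have := h.2 x
  rwa [← (Equiv.addRight α).iSup_comp] at this

/-- A family of subgroups that generates `T` is a direct sum decomposition if its components can
be separated by an additive map. -/
theorem isInternal_of_separated {G : Γ → AddSubgroup T} (D : T →+ (Γ →₀ T))
    (hD : ∀ γ, ∀ x ∈ G γ, D x = Finsupp.single γ x) (hG : ∀ x, x ∈ ⨆ γ, G γ) :
    DirectSum.IsInternal G := by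
  rw [isInternal_iff]
  refine ⟨iSupIndep_of_dfinsuppSumAddHom_injective' _ ?_, hG⟩
  have key : ∀ (y : DirectSum Γ fun i => G i) (γ : Γ),
      D (DirectSum.coeAddMonoidHom G y) γ = (y γ : T) := by
    intro y γ
    induction y using DirectSum.induction_on with
    | zero => simp
    | of i y =>
      rw [DirectSum.coeAddMonoidHom_of, hD i y y.2, DirectSum.coe_of_apply, Finsupp.single_apply]
      split_ifs <;> rfl
    | add y z hy hz => simp [hy, hz]
  intro y z hyz
  refine DFinsupp.ext fun γ => Subtype.ext ?_
  rw [← key y γ, ← key z γ]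
  exact DFunLike.congr_fun (congrArg D hyz) γ

/-- Elements of a direct sum decomposition can be tested on homogeneous elements. -/
theorem isInternal_induction {G : Γ → AddSubgroup T} (hG : DirectSum.IsInternal G)
    {p : T → Prop} (zero : p 0) (hom : ∀ γ, ∀ x ∈ G γ, p x)
    (add : ∀ x y, p x → p y → p (x + y)) (x : T) : p x := by
  exact AddSubgroup.iSup_induction G (C := p) (((isInternal_iff G).1 hG).2 x) hom zero add

end Internal

/-! ### Graded modules

Rings are graded by an abelian group `Γ`; a right `A`-module is a module over `Aᵐᵒᵖ`,
with `m a` written `op a • m`. -/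

section GradedModules

variable {Γ : Type w} [AddCommGroup Γ] [DecidableEq Γ] {A : Type u} [Ring A]

/-- A `Γ`-graded right module over the `Γ`-graded ring `(A, 𝒜)`. -/
structure GrMod (𝒜 : Γ → AddSubgroup A) where
  carrier : Type u
  [addCommGroup : AddCommGroup carrier]
  [module : Module Aᵐᵒᵖ carrier]
  /-- the homogeneous components -/
  deg : Γ → AddSubgroup carrier
  isInternal : DirectSum.IsInternal deg
  smul_mem : ∀ {α γ : Γ} {a : A} {m : carrier}, a ∈ 𝒜 α → m ∈ deg γ → op a • m ∈ deg (γ + α)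

attribute [instance] GrMod.addCommGroup GrMod.module

variable {𝒜 : Γ → AddSubgroup A}

instance : CoeSort (GrMod 𝒜) (Type u) := ⟨GrMod.carrier⟩

/-- `Hom_A(M, N)_δ`: the `A`-linear maps `f` with `f(M_γ) ⊆ N_{γ+δ}` for all `γ`. -/
def homDeg (M N : GrMod 𝒜) (δ : Γ) : AddSubgroup (M →ₗ[Aᵐᵒᵖ] N) where
  carrier := {f | ∀ γ : Γ, ∀ m ∈ M.deg γ, f m ∈ N.deg (γ + δ)}
  zero_mem' := fun _ _ _ => zero_mem _
  add_mem' := fun hf hg γ m hm => add_mem (hf γ m hm) (hg γ m hm)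
  neg_mem' := fun hf γ m hm => neg_mem (hf γ m hm)

/-- The category `Gr-A`: its morphisms are the graded homomorphisms (of degree `0`). -/
instance : Category (GrMod 𝒜) where
  Hom M N := homDeg M N 0
  id M := ⟨LinearMap.id, fun γ m hm => by simpa using hm⟩
  comp f g := ⟨g.1.comp f.1, fun γ m hm => by
    simpa using g.2 _ _ (f.2 γ m hm)⟩

/-- The linear map underlying a morphism of `Gr-A`. -/
def GrMod.toLin {M N : GrMod 𝒜} (f : M ⟶ N) : M →ₗ[Aᵐᵒᵖ] N := Subtype.val f

theorem GrMod.toLin_mem {M N : GrMod 𝒜} (f : M ⟶ N) {γ : Γ} {m : M} (hm : m ∈ M.deg γ) :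
    GrMod.toLin f m ∈ N.deg γ := by
  have := Subtype.property f γ m hm
  rwa [add_zero] at this

/-- A degree-preserving linear map as a morphism of `Gr-A`. -/
def GrMod.ofLin {M N : GrMod 𝒜} (f : M →ₗ[Aᵐᵒᵖ] N) (hf : ∀ γ, ∀ m ∈ M.deg γ, f m ∈ N.deg γ) :
    M ⟶ N :=
  ⟨f, fun γ m hm => by rw [add_zero]; exact hf γ m hm⟩

@[ext]
theorem GrMod.hom_ext {M N : GrMod 𝒜} {f g : M ⟶ N} (h : toLin f = toLin g) : f = g :=
  Subtype.ext h

@[simp] theorem GrMod.toLin_ofLin {M N : GrMod 𝒜} (f : M →ₗ[Aᵐᵒᵖ] N)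
    (hf : ∀ γ, ∀ m ∈ M.deg γ, f m ∈ N.deg γ) : toLin (ofLin f hf) = f := rfl

@[simp] theorem GrMod.toLin_id (M : GrMod 𝒜) : toLin (𝟙 M) = LinearMap.id := rfl

@[simp] theorem GrMod.toLin_comp {M N P : GrMod 𝒜} (f : M ⟶ N) (g : N ⟶ P) :
    toLin (f ≫ g) = (toLin g).comp (toLin f) := rfl

/-- Morphisms of `Gr-A` are added pointwise. -/
instance : Preadditive (GrMod 𝒜) where
  homGroup M N := inferInstanceAs (AddCommGroup (homDeg M N 0))
  add_comp := fun _ _ _ f f' g => Subtype.ext (LinearMap.comp_add (Subtype.val f)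
    (Subtype.val f') (Subtype.val g))
  comp_add := fun _ _ _ f g g' => Subtype.ext (LinearMap.add_comp (Subtype.val f)
    (Subtype.val g') (Subtype.val g))

/-- The shift `M(α)`, with `M(α)_γ = M_{γ+α}`. -/
def GrMod.shift (α : Γ) (M : GrMod 𝒜) : GrMod 𝒜 where
  carrier := M
  deg γ := M.deg (γ + α)
  isInternal := isInternal_shift M.isInternal α
  smul_mem := fun {β γ _ _} ha hm => by
    rw [add_right_comm γ β α]
    exact M.smul_mem ha hm

/-- The suspension functor `𝒯_α : Gr-A ⥤ Gr-A`, `M ↦ M(α)`. -/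
def suspension (𝒜 : Γ → AddSubgroup A) (α : Γ) : GrMod 𝒜 ⥤ GrMod 𝒜 where
  obj M := M.shift α
  map {M N} f := GrMod.ofLin (M := M.shift α) (N := N.shift α) (GrMod.toLin (M := M) (N := N) f)
    fun _ _ hm => GrMod.toLin_mem (M := M) (N := N) f hm

/-- The forgetful functor `U : Gr-A ⥤ Mod-A`. -/
def forgetGrading (𝒜 : Γ → AddSubgroup A) : GrMod 𝒜 ⥤ ModuleCat.{u} Aᵐᵒᵖ where
  obj M := ModuleCat.of Aᵐᵒᵖ M
  map f := ModuleCat.ofHom (GrMod.toLin f)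

/-- `P` is a graded generator: for every nonzero `f : M ⟶ N` in `Gr-A` there are `α` and
`g : P(α) ⟶ M` such that the composite `P(α) ⟶ M ⟶ N` is nonzero. -/
def IsGradedGenerator (P : GrMod 𝒜) : Prop :=
  ∀ ⦃M N : GrMod 𝒜⦄ (f : M ⟶ N), f ≠ 0 → ∃ (α : Γ) (g : P.shift α ⟶ M), g ≫ f ≠ 0

/-- A graded progenerator: a graded generator that is finitely generated and a projective
object of `Gr-A`. -/
def IsGradedProgenerator (P : GrMod 𝒜) : Prop :=
  Module.Finite Aᵐᵒᵖ P ∧ Projective P ∧ IsGradedGenerator P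

end GradedModules

section GradedRings

variable {Γ : Type w} [AddCommGroup Γ]

/-- `A ≅_gr B`: a ring isomorphism that identifies the homogeneous components. -/
def GradedIso {A B : Type*} [Ring A] [Ring B] (𝒜 : Γ → AddSubgroup A) (ℬ : Γ → AddSubgroup B) :
    Prop :=
  ∃ f : A ≃+* B, ∀ (γ : Γ) (a : A), a ∈ 𝒜 γ ↔ f a ∈ ℬ γ

/-- The components `End_A(P)_γ` of `End_A(P)`, whose product is composition of maps. -/
def endGrading [DecidableEq Γ] {A : Type u} [Ring A] {𝒜 : Γ → AddSubgroup A} (P : GrMod 𝒜) :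
    Γ → AddSubgroup (Module.End Aᵐᵒᵖ P) :=
  fun γ => homDeg P P γ

/-- The components of `M_n(A)(δ₁, …, δ_n)`: the `(i, j)` entry of a matrix of degree `γ` lies in
`A_{γ + δ_j - δ_i}`. -/
def matrixGrading {A : Type*} [Ring A] (𝒜 : Γ → AddSubgroup A) {n : ℕ} (δ : Fin n → Γ) (γ : Γ) :
    AddSubgroup (Matrix (Fin n) (Fin n) A) where
  carrier := {X | ∀ i j, X i j ∈ 𝒜 (γ + δ j - δ i)}
  zero_mem' := fun _ _ => zero_mem _
  add_mem' := fun hX hY i j => add_mem (hX i j) (hY i j)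
  neg_mem' := fun hX i j => neg_mem (hX i j)

/-- An idempotent `e` of `R` is full if `R e R = R`. -/
def IsFull {R : Type*} [Ring R] (e : R) : Prop :=
  AddSubgroup.closure {z : R | ∃ x y : R, z = x * e * y} = ⊤

/-- The components of the corner ring `e R e`, whose identity is `e`. -/
def cornerGrading {R : Type*} [Ring R] (ℛ : Γ → AddSubgroup R) {e : R} (he : IsIdempotentElem e)
    (γ : Γ) : AddSubgroup he.Corner where
  carrier := {x | x.1 ∈ ℛ γ}
  zero_mem' := zero_mem (ℛ γ)
  add_mem' := fun hx hy => add_mem (S := AddSubgroup R) hx hy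
  neg_mem' := fun hx => neg_mem (S := AddSubgroup R) hx

end GradedRings

section GradedFunctors

variable {Γ : Type w} [AddCommGroup Γ] [DecidableEq Γ] {A B : Type u} [Ring A] [Ring B]
  {𝒜 : Γ → AddSubgroup A} {ℬ : Γ → AddSubgroup B}

/-- A graded functor `φ : Gr-A ⥤ Gr-B`: an additive functor with `φ 𝒯_α = 𝒯_α φ` for all `α`. -/
def IsGradedFunctor (φ : GrMod 𝒜 ⥤ GrMod ℬ) : Prop :=
  φ.Additive ∧ ∀ α : Γ, suspension 𝒜 α ⋙ φ = φ ⋙ suspension ℬ α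

/-- A graded equivalence `Gr-A ⥤ Gr-B`: a graded functor with a graded quasi-inverse. The natural
isomorphisms need not be compatible with the suspensions. -/
def IsGradedEquivalence (φ : GrMod 𝒜 ⥤ GrMod ℬ) : Prop :=
  IsGradedFunctor φ ∧ ∃ ψ : GrMod ℬ ⥤ GrMod 𝒜, IsGradedFunctor ψ ∧
    Nonempty (φ ⋙ ψ ≅ 𝟭 (GrMod 𝒜)) ∧ Nonempty (ψ ⋙ φ ≅ 𝟭 (GrMod ℬ))

/-- `φ` is an associated graded functor of `φ' : Mod-A ⥤ Mod-B`: it is graded and `U φ = φ' U`. -/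
def IsAssociated (φ : GrMod 𝒜 ⥤ GrMod ℬ) (φ' : ModuleCat.{u} Aᵐᵒᵖ ⥤ ModuleCat.{u} Bᵐᵒᵖ) : Prop :=
  IsGradedFunctor φ ∧ φ ⋙ forgetGrading ℬ = forgetGrading 𝒜 ⋙ φ'

variable (𝒜 ℬ) in
/-- A graded equivalence `Mod-A ⥤ Mod-B`: an (additive) equivalence that has an associated graded
functor. -/
def IsGradedModEquivalence (φ' : ModuleCat.{u} Aᵐᵒᵖ ⥤ ModuleCat.{u} Bᵐᵒᵖ) : Prop :=
  φ'.Additive ∧ φ'.IsEquivalence ∧ ∃ φ : GrMod 𝒜 ⥤ GrMod ℬ, IsAssociated φ φ'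

end GradedFunctors

/-! ### Tensor products over a noncommutative ring -/

section Tensor

variable (A B : Type*) [Ring A] [Ring B] (M : Type*) [AddCommGroup M] [Module Aᵐᵒᵖ M]
  (Q : Type*) [AddCommGroup Q] [Module A Q] [Module Bᵐᵒᵖ Q]

/-- The relations `m a ⊗ q = m ⊗ a q`. The two factors of the tensor product over `ℤ` are written
in the opposite order, so that the right action of `B` on `Q` is an action on the first factor. -/
def balanced : Submodule Bᵐᵒᵖ (Q ⊗[ℤ] M) :=
  Submodule.span Bᵐᵒᵖ {x | ∃ (m : M) (a : A) (q : Q), x = q ⊗ₜ[ℤ] (op a • m) - (a • q) ⊗ₜ[ℤ] m}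

/-- The right `B`-module `M ⊗_A Q`, for a right `A`-module `M` and an `A`-`B`-bimodule `Q`. -/
abbrev Tens : Type _ := (Q ⊗[ℤ] M) ⧸ balanced A B M Q

variable {M Q} in
/-- The pure tensor `m ⊗ q` in `M ⊗_A Q`. -/
def Tens.tmul (m : M) (q : Q) : Tens A B M Q := (balanced A B M Q).mkQ (q ⊗ₜ[ℤ] m)

variable {A M} in
/-- `f ⊗_A Q : M ⊗_A Q → N ⊗_A Q`. -/
def Tens.map {N : Type*} [AddCommGroup N] [Module Aᵐᵒᵖ N] (f : M →ₗ[Aᵐᵒᵖ] N) :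
    Tens A B M Q →ₗ[Bᵐᵒᵖ] Tens A B N Q :=
  (balanced A B M Q).mapQ (balanced A B N Q)
    (TensorProduct.AlgebraTensorModule.lTensor Bᵐᵒᵖ Q f.toAddMonoidHom.toIntLinearMap) (by
      rw [balanced, Submodule.span_le]
      rintro _ ⟨m, a, q, rfl⟩
      refine Submodule.subset_span ⟨f m, a, q, ?_⟩
      simp)

theorem Tens.tmul_add (m : M) (q q' : Q) :
    Tens.tmul A B m (q + q') = Tens.tmul A B m q + Tens.tmul A B m q' := by
  simp [Tens.tmul, TensorProduct.add_tmul]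

theorem Tens.add_tmul (m m' : M) (q : Q) :
    Tens.tmul A B (m + m') q = Tens.tmul A B m q + Tens.tmul A B m' q := by
  simp [Tens.tmul, TensorProduct.tmul_add]

theorem Tens.smul_tmul (m : M) (a : A) (q : Q) :
    Tens.tmul A B (op a • m) q = Tens.tmul A B m (a • q) :=
  (Submodule.Quotient.eq _).2 (Submodule.subset_span ⟨m, a, q, rfl⟩)

theorem Tens.op_smul_tmul (m : M) (q : Q) (b : B) :
    op b • Tens.tmul A B m q = Tens.tmul A B m (op b • q) := rfl

@[simp] theorem Tens.map_tmul {N : Type*} [AddCommGroup N] [Module Aᵐᵒᵖ N] (f : M →ₗ[Aᵐᵒᵖ] N)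
    (m : M) (q : Q) : Tens.map B Q f (Tens.tmul A B m q) = Tens.tmul A B (f m) q := rfl

variable {A B M Q} in
theorem Tens.induction {p : Tens A B M Q → Prop} (zero : p 0)
    (tmul : ∀ m q, p (Tens.tmul A B m q)) (add : ∀ x y, p x → p y → p (x + y)) (x) : p x := by
  obtain ⟨x, rfl⟩ := Submodule.mkQ_surjective _ x
  induction x using TensorProduct.induction_on with
  | zero => exact zero
  | tmul q m => exact tmul m q
  | add x y hx hy => rw [map_add]; exact add _ _ hx hy

variable {A M} in
theorem Tens.map_id (x : Tens A B M Q) : Tens.map B Q (LinearMap.id (R := Aᵐᵒᵖ) (M := M)) x = x :=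
  Tens.induction (p := fun x => Tens.map B Q LinearMap.id x = x) (map_zero _)
    (fun _ _ => rfl) (fun x y hx hy => by rw [map_add, hx, hy]) x

variable {A M} in
theorem Tens.map_comp {N P : Type*} [AddCommGroup N] [Module Aᵐᵒᵖ N] [AddCommGroup P]
    [Module Aᵐᵒᵖ P] (f : M →ₗ[Aᵐᵒᵖ] N) (g : N →ₗ[Aᵐᵒᵖ] P) (x : Tens A B M Q) :
    Tens.map B Q (g.comp f) x = Tens.map B Q g (Tens.map B Q f x) :=
  Tens.induction (p := fun x => Tens.map B Q (g.comp f) x = Tens.map B Q g (Tens.map B Q f x))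
    (by simp only [map_zero]) (fun _ _ => rfl)
    (fun x y hx hy => by rw [map_add, map_add, map_add, hx, hy]) x

variable {A M Q} in
/-- The additive map out of `M ⊗_A Q` induced by a balanced biadditive map. -/
theorem Tens.exists_lift [SMulCommClass A Bᵐᵒᵖ Q] {T : Type*} [AddCommGroup T] (f : M →+ Q →+ T)
    (hf : ∀ (m : M) (a : A) (q : Q), f (op a • m) q = f m (a • q)) :
    ∃ g : Tens A B M Q →+ T, ∀ m q, g (Tens.tmul A B m q) = f m q := by
  let F : Q ⊗[ℤ] M →+ T := TensorProduct.liftAddHom f.flip (by intros; simp)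
  have hF : (balanced A B M Q).toAddSubgroup ≤ F.ker := by
    intro x hx
    have hx' : x ∈ balanced A B M Q := hx
    have hs : ∀ (b : Bᵐᵒᵖ) (m : M) (a : A) (q : Q),
        b • (q ⊗ₜ[ℤ] (op a • m) - (a • q) ⊗ₜ[ℤ] m) ∈ F.ker := by
      intro b m a q
      simp only [AddMonoidHom.mem_ker, smul_sub, map_sub, TensorProduct.smul_tmul']
      simp [F, hf, smul_comm a b q]
    refine Submodule.closure_induction (p := fun x _ => x ∈ F.ker) (zero_mem _)
      (fun x y _ _ => add_mem) ?_ hx'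
    rintro b _ ⟨m, a, q, rfl⟩
    exact hs b m a q
  exact ⟨QuotientAddGroup.lift _ F hF, fun m q => rfl⟩

end Tensor

section GradedTensor

variable {Γ : Type w} [AddCommGroup Γ] {A B : Type u} [Ring A] [Ring B]

/-- The components of `M ⊗_A Q`: the component of degree `γ` consists of the sums of the elements
`m ⊗ q` with `m` and `q` homogeneous and `deg m + deg q = γ`. -/
def tensGrading {M Q : Type*} [AddCommGroup M] [Module Aᵐᵒᵖ M] [AddCommGroup Q] [Module A Q]
    [Module Bᵐᵒᵖ Q] (ℳ : Γ → AddSubgroup M) (𝒬 : Γ → AddSubgroup Q)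
    (γ : Γ) : AddSubgroup (Tens A B M Q) :=
  AddSubgroup.closure {x | ∃ i j : Γ, i + j = γ ∧ ∃ m ∈ ℳ i, ∃ q ∈ 𝒬 j, x = Tens.tmul A B m q}

theorem tensGrading_smul_mem {M Q : Type*} [AddCommGroup M] [Module Aᵐᵒᵖ M] [AddCommGroup Q]
    [Module A Q] [Module Bᵐᵒᵖ Q] {ℬ : Γ → AddSubgroup B} {ℳ : Γ → AddSubgroup M}
    {𝒬 : Γ → AddSubgroup Q}
    (hQ : ∀ {β γ : Γ} {b : B} {q : Q}, b ∈ ℬ β → q ∈ 𝒬 γ → op b • q ∈ 𝒬 (γ + β))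
    {β γ : Γ} {b : B} {x : Tens A B M Q} (hb : b ∈ ℬ β) (hx : x ∈ tensGrading ℳ 𝒬 γ) :
    op b • x ∈ tensGrading (A := A) ℳ 𝒬 (γ + β) := by
  rw [tensGrading] at hx
  induction hx using AddSubgroup.closure_induction with
  | mem x hx =>
    obtain ⟨i, j, rfl, m, hm, q, hq, rfl⟩ := hx
    exact AddSubgroup.subset_closure ⟨i, j + β, (add_assoc i j β).symm, m, hm, op b • q,
      hQ hb hq, rfl⟩
  | zero => rw [smul_zero]; exact zero_mem _
  | add x y _ _ hx hy => rw [smul_add]; exact add_mem hx hy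
  | neg x _ hx => rw [smul_neg]; exact neg_mem hx

theorem tensGrading_map_mem {M N Q : Type*} [AddCommGroup M] [Module Aᵐᵒᵖ M] [AddCommGroup N]
    [Module Aᵐᵒᵖ N] [AddCommGroup Q] [Module A Q] [Module Bᵐᵒᵖ Q] {ℳ : Γ → AddSubgroup M}
    {𝒩 : Γ → AddSubgroup N} {𝒬 : Γ → AddSubgroup Q} (f : M →ₗ[Aᵐᵒᵖ] N)
    (hf : ∀ γ, ∀ m ∈ ℳ γ, f m ∈ 𝒩 γ) {γ : Γ} {x : Tens A B M Q} (hx : x ∈ tensGrading ℳ 𝒬 γ) :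
    Tens.map B Q f x ∈ tensGrading 𝒩 𝒬 γ := by
  rw [tensGrading] at hx
  induction hx using AddSubgroup.closure_induction with
  | mem x hx =>
    obtain ⟨i, j, rfl, m, hm, q, hq, rfl⟩ := hx
    exact AddSubgroup.subset_closure ⟨i, j, rfl, f m, hf i m hm, q, hq, rfl⟩
  | zero => rw [map_zero]; exact zero_mem _
  | add x y _ _ hx hy => rw [map_add]; exact add_mem hx hy
  | neg x _ hx => rw [map_neg]; exact neg_mem hx

variable [DecidableEq Γ]

/-- `M ⊗_A Q` is the direct sum of its homogeneous components. -/
theorem tensGrading_isInternal {M Q : Type*} [AddCommGroup M] [Module Aᵐᵒᵖ M] [AddCommGroup Q]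
    [Module A Q] [Module Bᵐᵒᵖ Q] [SMulCommClass A Bᵐᵒᵖ Q] {𝒜 : Γ → AddSubgroup A}
    {ℳ : Γ → AddSubgroup M} {𝒬 : Γ → AddSubgroup Q} (h𝒜 : DirectSum.IsInternal 𝒜)
    (hℳ : DirectSum.IsInternal ℳ) (h𝒬 : DirectSum.IsInternal 𝒬)
    (hM : ∀ {α γ : Γ} {a : A} {m : M}, a ∈ 𝒜 α → m ∈ ℳ γ → op a • m ∈ ℳ (γ + α))
    (hQ : ∀ {α γ : Γ} {a : A} {q : Q}, a ∈ 𝒜 α → q ∈ 𝒬 γ → a • q ∈ 𝒬 (α + γ)) :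
    DirectSum.IsInternal (tensGrading (A := A) (B := B) ℳ 𝒬) := by
  let tm : M →+ Q →+ Tens A B M Q := AddMonoidHom.mk'
    (fun m => AddMonoidHom.mk' (fun q => Tens.tmul A B m q) (Tens.tmul_add A B M Q m))
    (fun m m' => AddMonoidHom.ext fun q => Tens.add_tmul A B M Q m m' q)
  let _ := hℳ.chooseDecomposition
  let _ := h𝒬.chooseDecomposition
  let X := Γ →₀ Tens A B M Q
  let f₂ : ∀ i : Γ, Q →+ ℳ i →+ X := fun i =>
    (DirectSum.toAddMonoid fun j => (AddMonoidHom.flip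
      (((AddMonoidHom.compHom (Finsupp.singleAddHom (i + j))).comp
        ((AddMonoidHom.compHom.flip (𝒬 j).subtype).comp (tm.comp (ℳ i).subtype)))))).comp
      (DirectSum.decomposeAddEquiv 𝒬).toAddMonoidHom
  let f : M →+ Q →+ X := (DirectSum.toAddMonoid fun i => (f₂ i).flip).comp
    (DirectSum.decomposeAddEquiv ℳ).toAddMonoidHom
  have hf : ∀ i j m q, m ∈ ℳ i → q ∈ 𝒬 j →
      f m q = Finsupp.single (i + j) (Tens.tmul A B m q) := by
    intro i j m q hm hq
    simp [f, f₂, DirectSum.decompose_of_mem _ hm, DirectSum.decompose_of_mem _ hq, tm]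
  obtain ⟨D, hD⟩ := Tens.exists_lift B f (by
    intro m a q
    refine isInternal_induction h𝒜 (p := fun a => f (op a • m) q = f m (a • q)) (by simp) ?_
      (fun x y hx hy => by simp [add_smul, hx, hy]) a
    intro k a ha
    refine isInternal_induction hℳ (p := fun m => f (op a • m) q = f m (a • q)) (by simp) ?_
      (fun x y hx hy => by simp [smul_add, hx, hy]) m
    intro i m hm
    refine isInternal_induction h𝒬 (p := fun q => f (op a • m) q = f m (a • q)) (by simp) ?_
      (fun x y hx hy => by simp [smul_add, hx, hy]) q
    intro j q hq
    rw [hf _ _ _ _ (hM ha hm) hq, hf _ _ _ _ hm (hQ ha hq), add_assoc, Tens.smul_tmul])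
  refine isInternal_of_separated D ?_ ?_
  · intro γ x hx
    rw [tensGrading] at hx
    induction hx using AddSubgroup.closure_induction with
    | mem x hx =>
      obtain ⟨i, j, rfl, m, hm, q, hq, rfl⟩ := hx
      rw [hD, hf _ _ _ _ hm hq]
    | zero => simp
    | add x y _ _ hx hy => rw [map_add, hx, hy, Finsupp.single_add]
    | neg x _ hx => rw [map_neg, hx, Finsupp.single_neg]
  · refine fun x => Tens.induction (zero_mem _) (fun m q => ?_) (fun x y => add_mem) x
    refine isInternal_induction hℳ (p := fun m => Tens.tmul A B m q ∈ _) ?_ ?_ ?_ m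
    · rw [show Tens.tmul A B (0 : M) q = 0 from map_zero (tm.flip q)]; exact zero_mem _
    · intro i m hm
      refine isInternal_induction h𝒬 (p := fun q => Tens.tmul A B m q ∈ _) ?_ ?_ ?_ q
      · rw [show Tens.tmul A B m (0 : Q) = 0 from map_zero (tm m)]; exact zero_mem _
      · exact fun j q hq => AddSubgroup.mem_iSup_of_mem (i + j)
          (AddSubgroup.subset_closure ⟨i, j, rfl, m, hm, q, hq, rfl⟩)
      · exact fun x y hx hy => (Tens.tmul_add A B M Q m x y) ▸ add_mem hx hy
    · exact fun x y hx hy => (Tens.add_tmul A B M Q x y q) ▸ add_mem hx hy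

/-- A `Γ`-graded `A`-`B`-bimodule. -/
structure GrBimod (𝒜 : Γ → AddSubgroup A) (ℬ : Γ → AddSubgroup B) where
  carrier : Type u
  [addCommGroup : AddCommGroup carrier]
  [leftModule : Module A carrier]
  [rightModule : Module Bᵐᵒᵖ carrier]
  [smulCommClass : SMulCommClass A Bᵐᵒᵖ carrier]
  /-- the homogeneous components -/
  deg : Γ → AddSubgroup carrier
  isInternal : DirectSum.IsInternal deg
  left_smul_mem : ∀ {α γ : Γ} {a : A} {q : carrier}, a ∈ 𝒜 α → q ∈ deg γ → a • q ∈ deg (α + γ)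
  right_smul_mem : ∀ {β γ : Γ} {b : B} {q : carrier}, b ∈ ℬ β → q ∈ deg γ →
    op b • q ∈ deg (γ + β)

attribute [instance] GrBimod.addCommGroup GrBimod.leftModule GrBimod.rightModule
  GrBimod.smulCommClass

variable {𝒜 : Γ → AddSubgroup A} {ℬ : Γ → AddSubgroup B}

instance : CoeSort (GrBimod 𝒜 ℬ) (Type u) := ⟨GrBimod.carrier⟩

/-- The functor `- ⊗_A Q : Mod-A ⥤ Mod-B`. -/
noncomputable def GrBimod.tensor (Q : GrBimod 𝒜 ℬ) :
    ModuleCat.{u} Aᵐᵒᵖ ⥤ ModuleCat.{u} Bᵐᵒᵖ where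
  obj M := ModuleCat.of Bᵐᵒᵖ (Tens A B M Q)
  map f := ModuleCat.ofHom (Tens.map B Q f.hom)
  map_id _ := ModuleCat.hom_ext <| LinearMap.ext <| Tens.map_id B Q
  map_comp f g := ModuleCat.hom_ext <| LinearMap.ext <| Tens.map_comp B Q f.hom g.hom

/-- The graded right `B`-module `M ⊗_A Q`. -/
noncomputable def GrBimod.tensorObj [GradedRing 𝒜] (Q : GrBimod 𝒜 ℬ) (M : GrMod 𝒜) : GrMod ℬ where
  carrier := Tens A B M Q
  deg := tensGrading M.deg Q.deg
  isInternal := tensGrading_isInternal (DirectSum.Decomposition.isInternal 𝒜) M.isInternal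
    Q.isInternal M.smul_mem Q.left_smul_mem
  smul_mem := fun hb hx => tensGrading_smul_mem Q.right_smul_mem hb hx

/-- The functor `- ⊗_A Q : Gr-A ⥤ Gr-B`. -/
noncomputable def GrBimod.grTensor [GradedRing 𝒜] (Q : GrBimod 𝒜 ℬ) : GrMod 𝒜 ⥤ GrMod ℬ where
  obj M := Q.tensorObj M
  map {M N} f := GrMod.ofLin (M := Q.tensorObj M) (N := Q.tensorObj N)
    (Tens.map B Q (GrMod.toLin f)) fun _ _ hx =>
      tensGrading_map_mem (GrMod.toLin f) (fun _ _ hm => GrMod.toLin_mem f hm) hx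
  map_id _ := GrMod.hom_ext <| LinearMap.ext <| Tens.map_id B Q
  map_comp f g := GrMod.hom_ext <| LinearMap.ext <|
    Tens.map_comp B Q (GrMod.toLin f) (GrMod.toLin g)

end GradedTensor

end GradedMorita

/-!
Homogeneous maps `M → N` of degree `γ` are the morphisms `M ⟶ N(γ)`, so a graded functor `φ` acts on
homogeneous maps of every degree. An element of `M_γ` is a homogeneous map `A → M` of degree `γ`;
hence `φ` turns the elements of `M` into maps `φ(A) → φ(M)`. For `M = A` this is a left action of
`A` on `Q = φ(A)`, making `Q` a graded bimodule. When `φ` is an equivalence, or is associated with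
one on `Mod-A`, `A` acts on `Q` as its full ring of `B`-endomorphisms, and `Q` is a progenerator
over `B`. Such a `Q` makes `- ⊗_A Q` and `Hom_B(Q, -)` mutually inverse, both with and without the
grading: `Hom_B(Q, -)` is graded because `Q` is finitely generated. If `φ` is an equivalence, the
isomorphism `M ≅ Hom_B(Q, φ(M))` then gives `φ ≅ - ⊗_A Q`.

A graded progenerator `P` is a retract of a graded free module `A^n(δ)`, that is, the image of an
idempotent `e` of degree zero in its endomorphism ring `M_n(A)(δ)`. Then `End(P)` is the corner of
`e`, and `P` is a generator exactly when `e` is full.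
-/

namespace GradedMorita

/-! ### Homogeneous components -/

section Components

open DirectSum

variable {Γ T : Type*} [AddCommGroup T] (G : Γ → AddSubgroup T)

theorem iSupIndep_of_separating [AddGroup Γ] {ι : Type*} {X : ι → Type*}
    [∀ i, AddCommGroup (X i)] {H : ∀ i, Γ → AddSubgroup (X i)} (hH : ∀ i, iSupIndep (H i))
    (t : ∀ i, T →+ X i) (d : ι → Γ) (ht : ∀ i γ, ∀ x ∈ G γ, t i x ∈ H i (γ + d i))
    (hsep : ∀ x, (∀ i, t i x = 0) → x = 0) : iSupIndep G := by
  rw [iSupIndep_def]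
  refine fun γ => AddSubgroup.disjoint_def.2 fun {x} hx hx' => hsep x fun i => ?_
  refine AddSubgroup.disjoint_def.1
    (((hH i).comp (add_left_injective (d i))) γ) (ht i γ x hx) ?_
  have hle : (⨆ (j) (_ : j ≠ γ), G j).map (t i) ≤ ⨆ (j) (_ : j ≠ γ), H i (j + d i) := by
    simp only [AddSubgroup.map_iSup]
    exact iSup₂_mono fun j _ => AddSubgroup.map_le_iff_le_comap.2 (ht i j)
  exact hle (AddSubgroup.mem_map_of_mem _ hx')

variable [DecidableEq Γ] [Decomposition G]

/-- The additive map on `T = ⨁ G_γ` given by `f γ` on the component `G_γ`. -/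
noncomputable def liftComponents {X : Type*} [AddCommGroup X] (f : ∀ γ, G γ →+ X) : T →+ X :=
  (toAddMonoid f).comp (decomposeAddEquiv G).toAddMonoidHom

theorem liftComponents_of_mem {X : Type*} [AddCommGroup X] (f : ∀ γ, G γ →+ X) {γ : Γ} {x : T}
    (hx : x ∈ G γ) : liftComponents G f x = f γ ⟨x, hx⟩ := by
  simp [liftComponents, decompose_of_mem G hx]

variable {G}

theorem ext_homogeneous {X : Type*} [AddCommGroup X] {f g : T →+ X}
    (h : ∀ γ, ∀ x ∈ G γ, f x = g x) : f = g :=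
  AddMonoidHom.ext <| Decomposition.inductionOn G (by simp) (fun {γ} x => h γ x x.2)
    fun x y hx hy => by rw [map_add, map_add, hx, hy]

variable {Γ' T' : Type*} [DecidableEq Γ'] [AddCommGroup T'] {G' : Γ' → AddSubgroup T'}
  [Decomposition G']

theorem map_decompose (f : T →+ T') {σ : Γ → Γ'} (hσ : σ.Injective)
    (hf : ∀ γ, ∀ x ∈ G γ, f x ∈ G' (σ γ)) (x : T) (γ : Γ) :
    f (decompose G x γ) = decompose G' (f x) (σ γ) := by
  induction x using Decomposition.inductionOn G with
  | zero => simp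
  | @homogeneous γ' x =>
    rcases eq_or_ne γ' γ with rfl | hne
    · rw [decompose_of_mem_same G x.2, decompose_of_mem_same G' (hf _ x x.2)]
    · rw [decompose_of_mem_ne G x.2 hne, map_zero,
        decompose_of_mem_ne G' (hf _ x x.2) (hσ.ne hne)]
  | add x y hx hy =>
    simp only [decompose_add, map_add, DirectSum.add_apply, AddSubgroup.coe_add, hx, hy]

theorem eq_zero_of_decompose_eq_zero {x : T} (h : ∀ γ, (decompose G x γ : T) = 0) : x = 0 := by
  rw [← (decompose G).injective.eq_iff, decompose_zero]
  exact DFinsupp.ext fun γ => Subtype.ext (h γ)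

theorem mem_of_map_mem (f : T →+ T') {σ : Γ → Γ'} (hσ : σ.Injective)
    (hf : ∀ γ, ∀ x ∈ G γ, f x ∈ G' (σ γ)) (hinj : Function.Injective f) {x : T} {γ : Γ}
    (hx : f x ∈ G' (σ γ)) : x ∈ G γ := by
  have hcomp : (decompose G x γ : T) = x :=
    hinj ((map_decompose f hσ hf x γ).trans (decompose_of_mem_same G' hx))
  exact hcomp ▸ SetLike.coe_mem _

theorem bijective_of_components (f : T →+ T') {σ : Γ → Γ'} (hσ : σ.Injective)
    (hmem : ∀ γ, ∀ x ∈ G γ, f x ∈ G' (σ γ)) (hinj : ∀ γ, ∀ x ∈ G γ, f x = 0 → x = 0)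
    (hsurj : ∀ γ, ∀ y ∈ G' γ, ∃ x, f x = y) : Function.Bijective f := by
  refine ⟨(injective_iff_map_eq_zero f).2 fun x hx => ?_, fun y => ?_⟩
  · refine eq_zero_of_decompose_eq_zero (G := G) fun γ => hinj γ _ (SetLike.coe_mem _) ?_
    rw [map_decompose f hσ hmem, hx, decompose_zero]
    rfl
  · have hle : ⨆ γ, G' γ ≤ f.range := iSup_le fun γ y hy => hsurj γ y hy
    exact hle (((isInternal_iff G').1 (Decomposition.isInternal G')).2 y)

end Components

section GradedModules

open DirectSum

variable {Γ : Type w} [AddCommGroup Γ] [DecidableEq Γ] {A : Type u} [Ring A]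
  {𝒜 : Γ → AddSubgroup A}

namespace GrMod

noncomputable instance (M : GrMod 𝒜) : Decomposition M.deg :=
  M.isInternal.chooseDecomposition

theorem linearMap_ext_homogeneous {M : GrMod 𝒜} {N : Type*} [AddCommGroup N] [Module Aᵐᵒᵖ N]
    {f g : M →ₗ[Aᵐᵒᵖ] N} (h : ∀ γ, ∀ m ∈ M.deg γ, f m = g m) : f = g :=
  LinearMap.toAddMonoidHom_injective (ext_homogeneous (G := M.deg) h)

theorem toLin_sum_apply {M N : GrMod 𝒜} {ι : Type*} (s : Finset ι) (f : ι → (M ⟶ N)) (m : M) :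
    toLin (∑ i ∈ s, f i) m = ∑ i ∈ s, toLin (f i) m :=
  (LinearMap.congr_fun (map_sum (homDeg M N 0).subtype f s) m).trans (LinearMap.sum_apply _ _ m)

theorem toLin_decompose {M N : GrMod 𝒜} (f : M ⟶ N) (m : M) (γ : Γ) :
    toLin f (decompose M.deg m γ) = decompose N.deg (toLin f m) γ :=
  map_decompose (G := M.deg) (G' := N.deg) (toLin f).toAddMonoidHom Function.injective_id
    (fun _ _ hm => toLin_mem f hm) m γ

/-- An element of `Hom_A(M, N)_δ` as a morphism `M ⟶ N(δ)`. -/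
def ofDeg {M N : GrMod 𝒜} {δ : Γ} (f : M →ₗ[Aᵐᵒᵖ] N) (hf : f ∈ homDeg M N δ) : M ⟶ N.shift δ :=
  ofLin (N := N.shift δ) f hf

/-- A bijective morphism of `Gr-A` as an isomorphism. -/
noncomputable def isoOfBijective {M N : GrMod 𝒜} (f : M ⟶ N) (hf : Function.Bijective (toLin f)) :
    M ≅ N where
  hom := f
  inv := ofLin (LinearEquiv.ofBijective (toLin f) hf).symm fun γ n hn => by
    refine mem_of_map_mem (G := M.deg) (G' := N.deg) (toLin f).toAddMonoidHom
      Function.injective_id (fun _ _ hm => toLin_mem f hm) hf.1 ?_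
    exact (LinearEquiv.apply_symm_apply (.ofBijective (toLin f) hf) n).symm ▸ hn
  hom_inv_id := hom_ext <| LinearMap.ext fun m =>
    LinearEquiv.symm_apply_apply (.ofBijective (toLin f) hf) m
  inv_hom_id := hom_ext <| LinearMap.ext fun n =>
    LinearEquiv.apply_symm_apply (.ofBijective (toLin f) hf) n

/-! ### Homogeneous submodules and quotients -/

theorem isHomogeneous_range {M N : GrMod 𝒜} (f : M ⟶ N) :
    (LinearMap.range (toLin f)).IsHomogeneous N.deg := by
  rintro γ _ ⟨m, rfl⟩
  exact ⟨decompose M.deg m γ, toLin_decompose f m γ⟩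

theorem isHomogeneous_iSup {M : GrMod 𝒜} {ι : Type*} {N : ι → Submodule Aᵐᵒᵖ M}
    (hN : ∀ i, (N i).IsHomogeneous M.deg) : (⨆ i, N i).IsHomogeneous M.deg := by
  intro γ m hm
  induction hm using Submodule.iSup_induction' with
  | mem i m hm => exact Submodule.mem_iSup_of_mem i (hN i γ hm)
  | zero => simp
  | add m m' _ _ hm hm' =>
    rw [decompose_add]
    exact add_mem hm hm'

/-- The graded quotient module `M/N`, whose components are the images of those of `M`. -/
def quotient (M : GrMod 𝒜) (N : Submodule Aᵐᵒᵖ M) (hN : N.IsHomogeneous M.deg) : GrMod 𝒜 where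
  carrier := M ⧸ N
  deg γ := (M.deg γ).map N.mkQ.toAddMonoidHom
  isInternal := by
    let D : M →+ Γ →₀ M ⧸ N := liftComponents M.deg fun γ =>
      (Finsupp.singleAddHom γ).comp (N.mkQ.toAddMonoidHom.comp (M.deg γ).subtype)
    have hD : ∀ γ, ∀ m ∈ M.deg γ, D m = Finsupp.single γ (N.mkQ m) := fun γ m hm =>
      liftComponents_of_mem M.deg _ hm
    have hDN : N.toAddSubgroup ≤ D.ker := by
      intro m (hm : m ∈ N)
      classical
      rw [AddMonoidHom.mem_ker, ← sum_support_decompose M.deg m, map_sum]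
      refine Finset.sum_eq_zero fun γ _ => ?_
      rw [hD γ _ (SetLike.coe_mem _), Submodule.mkQ_apply,
        (Submodule.Quotient.mk_eq_zero N).2 (hN γ hm), Finsupp.single_zero]
    refine isInternal_of_separated (QuotientAddGroup.lift N.toAddSubgroup D hDN) ?_ ?_
    · rintro γ _ ⟨m, hm, rfl⟩
      exact hD γ m hm
    · refine Submodule.mkQ_surjective N |>.forall.2 fun m => ?_
      have hm := ((isInternal_iff M.deg).1 M.isInternal).2 m
      rw [← AddSubgroup.map_iSup]
      exact AddSubgroup.mem_map_of_mem _ hm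
  smul_mem := by
    rintro α γ a _ ha ⟨m, hm, rfl⟩
    exact ⟨op a • m, M.smul_mem ha hm, map_smul N.mkQ _ _⟩

/-- The projection `M ⟶ M/N`. -/
def quotientMk (M : GrMod 𝒜) (N : Submodule Aᵐᵒᵖ M) (hN : N.IsHomogeneous M.deg) :
    M ⟶ M.quotient N hN :=
  ofLin (N := M.quotient N hN) N.mkQ fun _ _ hm => AddSubgroup.mem_map_of_mem _ hm

theorem eq_top_of_quotientMk_eq_zero {M : GrMod 𝒜} {N : Submodule Aᵐᵒᵖ M}
    (hN : N.IsHomogeneous M.deg) (h : M.quotientMk N hN = 0) : N = ⊤ := by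
  rw [← Submodule.ker_mkQ N, LinearMap.ker_eq_top]
  exact congrArg toLin h

theorem surjective_of_epi {M N : GrMod 𝒜} (f : M ⟶ N) [Epi f] : Function.Surjective (toLin f) := by
  rw [← LinearMap.range_eq_top]
  refine eq_top_of_quotientMk_eq_zero (isHomogeneous_range f) (Preadditive.epi_iff_cancel_zero f
    |>.1 inferInstance _ _ (hom_ext <| LinearMap.ext fun m => ?_))
  exact (Submodule.Quotient.mk_eq_zero _).2 (LinearMap.mem_range_self _ m)

theorem epi_of_surjective {M N : GrMod 𝒜} (f : M ⟶ N) (hf : Function.Surjective (toLin f)) :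
    Epi f :=
  ⟨fun _ _ e => hom_ext <| LinearMap.ext <| hf.forall.2
    fun m => LinearMap.congr_fun (congrArg toLin e) m⟩

end GrMod

theorem IsGradedGenerator.iSup_range_eq_top {P : GrMod 𝒜}
    (hP : IsGradedGenerator P) (M : GrMod 𝒜) :
    ⨆ i : Σ α, P.shift α ⟶ M, LinearMap.range (GrMod.toLin i.2) = ⊤ := by
  have hN := GrMod.isHomogeneous_iSup fun i : Σ α, P.shift α ⟶ M => GrMod.isHomogeneous_range i.2
  refine GrMod.eq_top_of_quotientMk_eq_zero hN (by_contra fun h => ?_)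
  obtain ⟨α, g, hg⟩ := hP _ h
  refine hg (GrMod.hom_ext <| LinearMap.ext fun p => (Submodule.Quotient.mk_eq_zero _).2 ?_)
  exact Submodule.mem_iSup_of_mem (⟨α, g⟩ : Σ α, P.shift α ⟶ M) (LinearMap.mem_range_self _ p)

end GradedModules

section FiniteModules

open DirectSum

variable {Γ : Type w} [AddCommGroup Γ] [DecidableEq Γ] {A : Type u} [Ring A]
  {𝒜 : Γ → AddSubgroup A}

/-- The linear map `A → M`, `a ↦ m a`. -/
def eltLin {M : Type*} [AddCommGroup M] [Module Aᵐᵒᵖ M] (m : M) : A →ₗ[Aᵐᵒᵖ] M where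
  toFun a := op a • m
  map_add' a b := by rw [MulOpposite.op_add, add_smul]
  map_smul' a b := by
    rw [MulOpposite.smul_eq_mul_unop, MulOpposite.op_mul, op_unop, mul_smul, RingHom.id_apply]

@[simp] theorem eltLin_apply {M : Type*} [AddCommGroup M] [Module Aᵐᵒᵖ M] (m : M) (a : A) :
    eltLin m a = op a • m := rfl

theorem eltLin_map_one {M : Type*} [AddCommGroup M] [Module Aᵐᵒᵖ M] (f : A →ₗ[Aᵐᵒᵖ] M) :
    eltLin (f 1) = f :=
  LinearMap.ext fun a => by rw [eltLin_apply, ← map_smul, op_smul_eq_mul, one_mul]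

/-- The identification of `M` with `Hom_A(A, M)`. -/
def eltLinEquiv (M : Type*) [AddCommGroup M] [Module Aᵐᵒᵖ M] : M ≃+ (A →ₗ[Aᵐᵒᵖ] M) where
  toFun m := eltLin m
  invFun f := f 1
  left_inv m := one_smul _ m
  right_inv f := eltLin_map_one f
  map_add' m m' := LinearMap.ext fun a => smul_add (op a) m m'

namespace GrMod

theorem exists_homogeneous_generators (M : GrMod 𝒜) [Module.Finite Aᵐᵒᵖ M] :
    ∃ (n : ℕ) (d : Fin n → Γ) (x : Fin n → M), (∀ i, x i ∈ M.deg (d i)) ∧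
      Submodule.span Aᵐᵒᵖ (Set.range x) = ⊤ := by
  classical
  have hspan : Submodule.span Aᵐᵒᵖ {m | SetLike.IsHomogeneousElem M.deg m} = ⊤ := by
    refine Submodule.eq_top_iff'.2 fun m => ?_
    rw [← sum_support_decompose M.deg m]
    exact sum_mem fun γ _ => Submodule.subset_span ⟨γ, SetLike.coe_mem _⟩
  obtain ⟨S, hS, hspanS⟩ := (Submodule.fg_span_iff_fg_span_finset_subset _).1
    (hspan ▸ Module.Finite.fg_top)
  choose d hd using fun i => hS (S.equivFin.symm i).2
  refine ⟨S.card, d, fun i => S.equivFin.symm i, hd, ?_⟩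
  rw [← hspan, hspanS, Set.range_comp', S.equivFin.symm.surjective.range_eq, Set.image_univ,
    Subtype.range_coe]

theorem decompose_smul (M : GrMod 𝒜) {α : Γ} {a : A} (ha : a ∈ 𝒜 α) (m : M) (γ : Γ) :
    (decompose M.deg (op a • m) (γ + α) : M) = op a • (decompose M.deg m γ : M) :=
  (map_decompose (G := M.deg) (DistribSMul.toAddMonoidHom M (op a)) (add_left_injective α)
    (fun _ _ hm => M.smul_mem ha hm) m γ).symm

section GradedRing

variable [GradedRing 𝒜]

/-- The graded right module `A`. -/
def regular (𝒜 : Γ → AddSubgroup A) [GradedRing 𝒜] : GrMod 𝒜 where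
  carrier := A
  deg := 𝒜
  isInternal := Decomposition.isInternal 𝒜
  smul_mem := fun ha hm => SetLike.mul_mem_graded hm ha

theorem eltLin_mem_homDeg {M : GrMod 𝒜} {γ : Γ} {m : M} (hm : m ∈ M.deg γ) :
    eltLin m ∈ homDeg (regular 𝒜) M γ := fun α a ha => by
  rw [add_comm]
  exact M.smul_mem ha hm

/-- The component of degree `δ` of a linear map `f`: it sends `m ∈ M_γ` to `(f m)_{γ+δ}`. -/
noncomputable def homComponent {M N : GrMod 𝒜} (δ : Γ) (f : M →ₗ[Aᵐᵒᵖ] N) : M →ₗ[Aᵐᵒᵖ] N :=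
  let F : M →+ N := liftComponents M.deg fun γ => (N.deg (γ + δ)).subtype.comp <|
    (DFinsupp.evalAddMonoidHom (γ + δ)).comp <|
      (decomposeAddEquiv N.deg).toAddMonoidHom.comp <| f.toAddMonoidHom.comp (M.deg γ).subtype
  have hF : ∀ γ, ∀ m ∈ M.deg γ, F m = decompose N.deg (f m) (γ + δ) := fun _ _ hm =>
    liftComponents_of_mem M.deg _ hm
  { F with
    map_smul' := by
      refine op_surjective.forall.2 fun a m => ?_
      induction a using Decomposition.inductionOn 𝒜 with
      | zero => simp
      | @homogeneous α a =>
        revert m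
        refine DFunLike.congr_fun (ext_homogeneous (G := M.deg)
          (f := F.comp (DistribSMul.toAddMonoidHom M (op (a : A))))
          (g := (DistribSMul.toAddMonoidHom N (op (a : A))).comp F) fun γ m hm => ?_)
        change F (op (a : A) • m) = op (a : A) • F m
        rw [hF γ m hm, hF _ _ (M.smul_mem a.2 hm), map_smul, add_right_comm,
          N.decompose_smul a.2]
      | add a b ha hb => simp_all [add_smul] }

theorem homComponent_of_mem {M N : GrMod 𝒜} (δ : Γ) (f : M →ₗ[Aᵐᵒᵖ] N) {γ : Γ} {m : M}
    (hm : m ∈ M.deg γ) : homComponent δ f m = decompose N.deg (f m) (γ + δ) :=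
  liftComponents_of_mem M.deg _ hm

theorem homComponent_mem_homDeg {M N : GrMod 𝒜} (δ : Γ) (f : M →ₗ[Aᵐᵒᵖ] N) :
    homComponent δ f ∈ homDeg M N δ := fun γ m hm => by
  rw [homComponent_of_mem δ f hm]
  exact SetLike.coe_mem _

theorem exists_eq_sum_homComponent {M N : GrMod 𝒜} [Module.Finite Aᵐᵒᵖ M]
    (f : M →ₗ[Aᵐᵒᵖ] N) : ∃ s : Finset Γ, f = ∑ δ ∈ s, homComponent δ f := by
  classical
  obtain ⟨n, d, x, hx, hspan⟩ := M.exists_homogeneous_generators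
  let supp (i : Fin n) : Finset Γ := (decompose N.deg (f (x i))).support
  refine ⟨Finset.univ.biUnion fun i => (supp i).image (· - d i),
    LinearMap.ext_on_range hspan fun i => ?_⟩
  simp only [LinearMap.sum_apply, homComponent_of_mem _ f (hx i)]
  rw [← Finset.sum_image (g := fun γ => d i + γ) (f := fun γ => (decompose N.deg (f (x i)) γ : N))
    fun a _ b _ hab => by simpa using hab]
  conv_lhs => rw [← sum_support_decompose N.deg (f (x i))]
  refine Finset.sum_subset (fun γ hγ => ?_) fun γ _ hγ => ?_
  · exact Finset.mem_image.2 ⟨γ - d i, Finset.mem_biUnion.2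
      ⟨i, Finset.mem_univ _, Finset.mem_image_of_mem _ hγ⟩, add_sub_cancel _ _⟩
  · rw [DFinsupp.notMem_support_iff.1 hγ, ZeroMemClass.coe_zero]

theorem isInternal_homDeg (M N : GrMod 𝒜) [Module.Finite Aᵐᵒᵖ M] :
    DirectSum.IsInternal (homDeg M N) := by
  refine (isInternal_iff _).2 ⟨?_, fun f => ?_⟩
  · exact iSupIndep_of_separating (ι := Σ γ, M.deg γ) _
      (fun _ => ((isInternal_iff N.deg).1 N.isInternal).1)
      (fun m => (LinearMap.applyₗ' ℤ (m.2 : M)).toAddMonoidHom) Sigma.fst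
      (fun m δ f hf => add_comm m.1 δ ▸ hf m.1 m.2 m.2.2)
      fun f hf => linearMap_ext_homogeneous fun γ m hm => hf ⟨γ, m, hm⟩
  · obtain ⟨s, hs⟩ := exists_eq_sum_homComponent f
    rw [hs]
    exact sum_mem fun δ _ => AddSubgroup.mem_iSup_of_mem δ (homComponent_mem_homDeg δ f)

/-- The graded free module with basis elements of degrees `d i`. -/
def free (𝒜 : Γ → AddSubgroup A) [GradedRing 𝒜] {n : ℕ} (d : Fin n → Γ) : GrMod 𝒜 where
  carrier := Fin n → A
  deg γ := AddSubgroup.pi Set.univ fun i => 𝒜 (γ - d i)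
  isInternal := by
    have h𝒜 := (isInternal_iff 𝒜).1 (Decomposition.isInternal 𝒜)
    refine (isInternal_iff _).2 ⟨?_, fun v => ?_⟩
    · exact iSupIndep_of_separating _ (fun _ => h𝒜.1) (Pi.evalAddMonoidHom fun _ => A) (-d)
        (fun i γ v hv => sub_eq_add_neg γ (d i) ▸ hv i trivial) fun _ => funext
    · rw [← Finset.univ_sum_single v]
      refine sum_mem fun i _ => ?_
      have hle : ⨆ γ, 𝒜 γ ≤ AddSubgroup.comap (AddMonoidHom.single (fun _ => A) i)
          (⨆ γ, AddSubgroup.pi Set.univ fun j => 𝒜 (γ - d j)) := by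
        refine iSup_le fun γ a ha => AddSubgroup.mem_iSup_of_mem (γ + d i) ?_
        exact (AddSubgroup.single_mem_pi (H := fun j => 𝒜 (γ + d i - d j)) i a).2 fun _ => by
          rwa [add_sub_cancel_right]
      exact hle (h𝒜.2 (v i))
  smul_mem := fun {α γ a v} ha hv i _ => by
    have := SetLike.mul_mem_graded (hv i trivial) ha
    rwa [sub_add_eq_add_sub] at this

/-- A homogeneous submodule as a graded module. -/
def ofSubmodule (M : GrMod 𝒜) (N : Submodule Aᵐᵒᵖ M) (hN : N.IsHomogeneous M.deg) :
    GrMod 𝒜 where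
  carrier := N
  deg γ := (M.deg γ).comap N.subtype.toAddMonoidHom
  isInternal := by
    refine (isInternal_iff _).2 ⟨?_, fun m => ?_⟩
    · exact iSupIndep_of_separating (ι := Unit) _
        (fun _ => ((isInternal_iff M.deg).1 M.isInternal).1)
        (fun _ => N.subtype.toAddMonoidHom) 0 (fun _ γ m hm => (add_zero γ).symm ▸ hm)
        fun m hm => Subtype.ext (hm ())
    · classical
      have hm : m = ∑ γ ∈ (decompose M.deg (m : M)).support,
          (⟨decompose M.deg (m : M) γ, hN γ m.2⟩ : N) :=
        Subtype.ext <| by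
          rw [AddSubmonoidClass.coe_finsetSum, sum_support_decompose]
      rw [hm]
      exact sum_mem fun γ _ => AddSubgroup.mem_iSup_of_mem γ
        (SetLike.coe_mem (decompose M.deg (m : M) γ))
  smul_mem := fun ha hm => M.smul_mem ha hm

end GradedRing

end GrMod

end FiniteModules

/-! ### Retracts of finite sums -/

section SumRetract

variable {C D : Type*} [Category C] [Preadditive C] [Category D] [Preadditive D] {ι : Type*}

/-- `X` is a retract of a finite direct sum of objects of the family `Y`. The sum does not have to
exist: only the components of the section and of the retraction are recorded. -/
def IsSumRetract (Y : ι → C) (X : C) : Prop :=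
  ∃ (n : ℕ) (i : Fin n → ι) (s : ∀ k, X ⟶ Y (i k)) (r : ∀ k, Y (i k) ⟶ X),
    ∑ k, s k ≫ r k = 𝟙 X

namespace IsSumRetract

theorem of_retract {Y : ι → C} {X X' : C} (hX : IsSumRetract Y X) (h : Retract X' X) :
    IsSumRetract Y X' := by
  obtain ⟨n, i, s, r, hsr⟩ := hX
  refine ⟨n, i, fun k => h.i ≫ s k, fun k => r k ≫ h.r, ?_⟩
  have hsum : ∑ k, (h.i ≫ s k) ≫ r k ≫ h.r = h.i ≫ (∑ k, s k ≫ r k) ≫ h.r := by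
    simp only [Preadditive.sum_comp, Preadditive.comp_sum, Category.assoc]
  rw [hsum, hsr, Category.id_comp, h.retract]

theorem map (F : C ⥤ D) [F.Additive] {Y : ι → C} {X : C} (hX : IsSumRetract Y X) {Y' : ι → D}
    (e : ∀ i, F.obj (Y i) ≅ Y' i) : IsSumRetract Y' (F.obj X) := by
  obtain ⟨n, i, s, r, hsr⟩ := hX
  refine ⟨n, i, fun k => F.map (s k) ≫ (e (i k)).hom, fun k => (e (i k)).inv ≫ F.map (r k), ?_⟩
  simp only [Category.assoc, Iso.hom_inv_id_assoc, ← F.map_comp, ← F.map_sum, hsr, F.map_id]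

theorem projective {Y : ι → C} {X : C} (hX : IsSumRetract Y X) (hY : ∀ i, Projective (Y i)) :
    Projective X where
  factors f e := by
    obtain ⟨n, i, s, r, hsr⟩ := hX
    refine ⟨∑ k, s k ≫ Projective.factorThru (r k ≫ f) e, ?_⟩
    simp only [Preadditive.sum_comp, Category.assoc, Projective.factorThru_comp]
    simp only [← Category.assoc, ← Preadditive.sum_comp, hsr, Category.id_comp]

end IsSumRetract

end SumRetract

section Modules

variable (A : Type u) [Ring A]

/-- `P` has a finite dual basis: it is a finitely generated projective right `A`-module. -/
def HasDualBasis (P : Type*) [AddCommGroup P] [Module Aᵐᵒᵖ P] : Prop :=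
  ∃ (n : ℕ) (x : Fin n → P) (ξ : Fin n → P →ₗ[Aᵐᵒᵖ] A), ∀ p, ∑ i, op (ξ i p) • x i = p

/-- The trace ideal of `P` is all of `A`: it is a generator of `Mod-A`. -/
def HasFullTrace (P : Type*) [AddCommGroup P] [Module Aᵐᵒᵖ P] : Prop :=
  ∃ (n : ℕ) (p : Fin n → P) (θ : Fin n → P →ₗ[Aᵐᵒᵖ] A), ∑ i, θ i (p i) = 1

variable {A}

theorem HasDualBasis.finite {P : Type*} [AddCommGroup P] [Module Aᵐᵒᵖ P] (h : HasDualBasis A P) :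
    Module.Finite Aᵐᵒᵖ P := by
  obtain ⟨n, x, ξ, hx⟩ := h
  refine Module.Finite.of_fg_top <| Submodule.fg_iff_exists_fin_generating_family.2
    ⟨n, x, Submodule.eq_top_iff'.2 fun p => ?_⟩
  rw [← hx p]
  exact sum_mem fun i _ => Submodule.smul_mem _ _ (Submodule.subset_span ⟨i, rfl⟩)

theorem IsSumRetract.hasDualBasis {P : ModuleCat.{u} Aᵐᵒᵖ} {ι : Type*}
    (h : IsSumRetract (fun _ : ι => ModuleCat.of Aᵐᵒᵖ A) P) : HasDualBasis A P := by
  obtain ⟨n, i, s, r, hsr⟩ := h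
  refine ⟨n, fun k => (r k).hom (1 : A), fun k => (s k).hom, fun p => ?_⟩
  have hp := congrArg (fun f : P ⟶ P => f.hom p) hsr
  simp only [ModuleCat.hom_sum, LinearMap.sum_apply, ModuleCat.hom_comp, LinearMap.comp_apply,
    ModuleCat.hom_id, LinearMap.id_apply] at hp
  refine (Finset.sum_congr rfl fun k _ => ?_).trans hp
  exact LinearMap.congr_fun (eltLin_map_one (r k).hom) _

theorem IsSumRetract.hasFullTrace {P : ModuleCat.{u} Aᵐᵒᵖ} {ι : Type*}
    (h : IsSumRetract (fun _ : ι => P) (ModuleCat.of Aᵐᵒᵖ A)) : HasFullTrace A P := by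
  obtain ⟨n, i, s, r, hsr⟩ := h
  refine ⟨n, fun k => (s k).hom (1 : A), fun k => (r k).hom, ?_⟩
  have h1 := congrArg (fun f : ModuleCat.of Aᵐᵒᵖ A ⟶ ModuleCat.of Aᵐᵒᵖ A => f.hom (1 : A)) hsr
  simpa only [ModuleCat.hom_sum, LinearMap.sum_apply, ModuleCat.hom_comp, LinearMap.comp_apply,
    ModuleCat.hom_id, LinearMap.id_apply] using h1

theorem exists_eq_sum_of_mem_iSup_range {R M ι : Type*} [Ring R] [AddCommGroup M] [Module R M]
    {P : ι → Type*} [∀ i, AddCommGroup (P i)] [∀ i, Module R (P i)] {g : ∀ i, P i →ₗ[R] M}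
    {m : M} (hm : m ∈ ⨆ i, LinearMap.range (g i)) :
    ∃ (n : ℕ) (i : Fin n → ι) (p : ∀ k, P (i k)), ∑ k, g (i k) (p k) = m := by
  obtain ⟨f, hf, rfl⟩ := (Submodule.mem_iSup_iff_exists_finsupp _ m).1 hm
  choose p hp using hf
  refine ⟨_, fun k => (f.support.equivFin.symm k : ι), fun _ => p _, ?_⟩
  simp only [hp]
  rw [Equiv.sum_comp f.support.equivFin.symm fun i => f i, Finset.sum_coe_sort f.support f]
  rfl

theorem isSumRetract_of_isSeparator {P : ModuleCat.{u} Aᵐᵒᵖ} (hP : IsSeparator P) :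
    IsSumRetract (fun _ : Unit => P) (ModuleCat.of Aᵐᵒᵖ A) := by
  let N : Submodule Aᵐᵒᵖ A := ⨆ g : P →ₗ[Aᵐᵒᵖ] A, LinearMap.range g
  have hN : ModuleCat.ofHom N.mkQ = 0 := by
    refine (Preadditive.isSeparator_iff P).1 hP _ fun g => ModuleCat.hom_ext <| LinearMap.ext
      fun p => (Submodule.Quotient.mk_eq_zero N).2 ?_
    exact Submodule.mem_iSup_of_mem g.hom (LinearMap.mem_range_self _ p)
  have h1 : (1 : A) ∈ N :=
    (Submodule.Quotient.mk_eq_zero N).1 (LinearMap.congr_fun (congrArg ModuleCat.Hom.hom hN) 1)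
  obtain ⟨n, g, p, hgp⟩ := exists_eq_sum_of_mem_iSup_range h1
  refine ⟨n, fun _ => (), fun k => ModuleCat.ofHom (eltLin (p k)),
    fun k => ModuleCat.ofHom (g k), ModuleCat.hom_ext <| LinearMap.ext fun a => ?_⟩
  rw [ModuleCat.hom_sum, LinearMap.sum_apply]
  refine (Finset.sum_congr rfl fun k _ => map_smul (g k) (op a) (p k)).trans ?_
  rw [← Finset.smul_sum, hgp]
  exact one_mul a

theorem isSeparator_regular : IsSeparator (ModuleCat.of Aᵐᵒᵖ A) :=
  (Preadditive.isSeparator_iff _).2 fun M N f hf => ModuleCat.hom_ext <| LinearMap.ext fun m => by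
    have hm := LinearMap.congr_fun (congrArg ModuleCat.Hom.hom
      (hf (ModuleCat.ofHom (X := A) (eltLin m)))) (1 : A)
    rw [← one_smul Aᵐᵒᵖ m]
    exact hm

variable {B : Type u} [Ring B] (F : ModuleCat.{u} Aᵐᵒᵖ ⥤ ModuleCat.{u} Bᵐᵒᵖ) [F.IsEquivalence]

theorem hasFullTrace_of_isEquivalence : HasFullTrace B (F.obj (ModuleCat.of Aᵐᵒᵖ A)) :=
  (isSumRetract_of_isSeparator (isSeparator_regular.of_equivalence F.asEquivalence)).hasFullTrace

theorem hasDualBasis_of_isEquivalence [F.Additive] :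
    HasDualBasis B (F.obj (ModuleCat.of Aᵐᵒᵖ A)) :=
  have hsep := isSeparator_regular.of_equivalence F.asEquivalence.symm
  ((isSumRetract_of_isSeparator hsep).map F fun _ => F.asEquivalence.counitIso.app _).hasDualBasis

end Modules

/-! ### Graded progenerators -/

section Progenerators

open DirectSum GrMod

variable {Γ : Type w} [AddCommGroup Γ] [DecidableEq Γ] {A : Type u} [Ring A]
  {𝒜 : Γ → AddSubgroup A} [GradedRing 𝒜]

/-- The map `A(α) ⟶ M`, `a ↦ m a`, for `m ∈ M_{-α}`. -/
def GrMod.eltHom {M : GrMod 𝒜} {α : Γ} {m : M} (hm : m ∈ M.deg (-α)) :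
    (regular 𝒜).shift α ⟶ M :=
  ofLin (M := (regular 𝒜).shift α) (eltLin m) fun β a ha => by
    have := eltLin_mem_homDeg hm (β + α) a ha
    rwa [add_neg_cancel_right] at this

theorem GrMod.toLin_eltHom {M : GrMod 𝒜} {α : Γ} {m : M} (hm : m ∈ M.deg (-α)) (a : A) :
    toLin (eltHom hm) a = op a • m :=
  rfl

theorem GrMod.toLin_map_one_mem {M : GrMod 𝒜} {α : Γ} (f : (regular 𝒜).shift α ⟶ M) :
    toLin f (1 : A) ∈ M.deg (-α) := by
  refine toLin_mem f ?_
  change (1 : A) ∈ 𝒜 (-α + α)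
  rw [neg_add_cancel]
  exact SetLike.one_mem_graded 𝒜

theorem GrMod.eltHom_map_one {M : GrMod 𝒜} {α : Γ} (f : (regular 𝒜).shift α ⟶ M) :
    eltHom (toLin_map_one_mem f) = f :=
  hom_ext (eltLin_map_one (toLin f))

theorem GrMod.eltHom_comp {M N : GrMod 𝒜} {α : Γ} {m : M} (hm : m ∈ M.deg (-α)) (f : M ⟶ N) :
    eltHom hm ≫ f = eltHom (toLin_mem f hm) :=
  hom_ext <| LinearMap.ext fun (a : A) => map_smul (toLin f) (op a) m

theorem isGradedGenerator_regular : IsGradedGenerator (regular 𝒜) := by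
  refine fun M N f hf => by_contra fun hzero => hf (hom_ext <| linearMap_ext_homogeneous ?_)
  push Not at hzero
  intro γ m hm
  rw [← neg_neg γ] at hm
  have hfm := LinearMap.congr_fun (congrArg toLin (hzero (-γ) (eltHom hm))) (1 : A)
  rwa [eltHom_comp, toLin_eltHom, op_one, one_smul] at hfm

theorem projective_shift_regular (α : Γ) : Projective ((regular 𝒜).shift α) where
  factors {M N} f e _ := by
    have hf := toLin_map_one_mem f
    obtain ⟨m, hm⟩ := surjective_of_epi e (toLin f (1 : A))
    have hdeg : (decompose M.deg m (-α) : M) ∈ M.deg (-α) := SetLike.coe_mem _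
    refine ⟨eltHom hdeg, ?_⟩
    rw [← eltHom_map_one f, eltHom_comp]
    congr 1
    rw [toLin_decompose, hm, decompose_of_mem_same N.deg hf]

theorem isSumRetract_free {n : ℕ} (d : Fin n → Γ) :
    IsSumRetract (fun α => (regular 𝒜).shift α) (free 𝒜 d) := by
  refine ⟨n, fun i => -d i,
    fun i => ofLin (M := free 𝒜 d) (N := (regular 𝒜).shift (-d i)) (LinearMap.proj i) ?_,
    fun i => ofLin (M := (regular 𝒜).shift (-d i)) (N := free 𝒜 d)
      (LinearMap.single Aᵐᵒᵖ (fun _ => A) i) ?_, ?_⟩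
  · intro γ v hv
    change v i ∈ 𝒜 (γ + -d i)
    exact sub_eq_add_neg γ (d i) ▸ hv i trivial
  · intro γ a ha
    exact (AddSubgroup.single_mem_pi (H := fun j => 𝒜 (γ - d j)) i a).2 fun _ =>
      sub_eq_add_neg γ (d i) ▸ ha
  · refine hom_ext <| LinearMap.ext fun (v : Fin n → A) => ?_
    refine (toLin_sum_apply _ _ _).trans ?_
    exact Finset.univ_sum_single v

/-- The map `A^n → M`, `v ↦ ∑ x_i v_i`. -/
def linComb {M : Type*} [AddCommGroup M] [Module Aᵐᵒᵖ M] {n : ℕ} (x : Fin n → M) :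
    (Fin n → A) →ₗ[Aᵐᵒᵖ] M :=
  ∑ i, (eltLin (x i)).comp (LinearMap.proj i)

theorem linComb_apply {M : Type*} [AddCommGroup M] [Module Aᵐᵒᵖ M] {n : ℕ} (x : Fin n → M)
    (v : Fin n → A) : linComb x v = ∑ i, op (v i) • x i := by
  simp [linComb]

theorem linComb_single {M : Type*} [AddCommGroup M] [Module Aᵐᵒᵖ M] {n : ℕ} (x : Fin n → M)
    (i : Fin n) : linComb x (Pi.single i (1 : A)) = x i := by
  rw [linComb_apply, Finset.sum_eq_single i (fun j _ hji => by
    rw [Pi.single_eq_of_ne hji, op_zero, zero_smul]) (by simp), Pi.single_eq_same, op_one, one_smul]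

/-- The map from a graded free module that sends the basis to given homogeneous elements. -/
def GrMod.freeDesc {M : GrMod 𝒜} {n : ℕ} {d : Fin n → Γ} {x : Fin n → M}
    (hx : ∀ i, x i ∈ M.deg (d i)) : free 𝒜 d ⟶ M :=
  ofLin (M := free 𝒜 d) (linComb x) fun γ (v : Fin n → A) hv => by
    have hsum : ∑ i, op (v i) • x i ∈ M.deg γ := sum_mem fun i _ => by
      have := M.smul_mem (hv i trivial) (hx i)
      rwa [add_sub_cancel] at this
    exact (linComb_apply x v).symm ▸ hsum

theorem GrMod.exists_retract_free (P : GrMod 𝒜) [Module.Finite Aᵐᵒᵖ P] [Projective P] :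
    ∃ (n : ℕ) (_ : 0 < n) (d : Fin n → Γ), Nonempty (Retract P (free 𝒜 d)) := by
  obtain ⟨n, d, x, hx, hspan⟩ := P.exists_homogeneous_generators
  let d₀ : Fin (n + 1) → Γ := Fin.cons 0 d
  let x₀ : Fin (n + 1) → P := Fin.cons 0 x
  have hx₀ : ∀ i, x₀ i ∈ P.deg (d₀ i) := Fin.cases (zero_mem _) hx
  have : Epi (freeDesc hx₀) := epi_of_surjective _ <| by
    rw [← LinearMap.range_eq_top, eq_top_iff, ← hspan, Submodule.span_le]
    rintro _ ⟨i, rfl⟩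
    exact ⟨_, linComb_single x₀ i.succ⟩
  exact ⟨n + 1, n.succ_pos, d₀,
    ⟨⟨Projective.factorThru (𝟙 P) (freeDesc hx₀), freeDesc hx₀, Projective.factorThru_comp _ _⟩⟩⟩

theorem isSumRetract_shift_regular (P : GrMod 𝒜) [Module.Finite Aᵐᵒᵖ P] [Projective P] :
    IsSumRetract (fun α => (regular 𝒜).shift α) P :=
  have ⟨_, _, d, ⟨h⟩⟩ := P.exists_retract_free
  (isSumRetract_free d).of_retract h

theorem IsGradedGenerator.isSumRetract_regular {P : GrMod 𝒜} (hP : IsGradedGenerator P) :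
    IsSumRetract (fun α => P.shift α) (regular 𝒜) := by
  let one : regular 𝒜 := (1 : A)
  have hone : one ∈ ⨆ i : Σ α, P.shift α ⟶ regular 𝒜, LinearMap.range (toLin i.2) := by
    rw [hP.iSup_range_eq_top (regular 𝒜)]
    trivial
  obtain ⟨n, g, p, hgp⟩ := exists_eq_sum_of_mem_iSup_range hone
  let p₀ k : P.shift (g k).1 := decompose (P.shift (g k).1).deg (p k) 0
  have hp₀ k : p₀ k ∈ P.deg (0 + (g k).1) := SetLike.coe_mem _
  have hgp₀ : ∑ k, toLin (g k).2 (p₀ k) = one := calc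
    _ = ∑ k, (decompose (regular 𝒜).deg (toLin (g k).2 (p k)) 0 : regular 𝒜) :=
      Finset.sum_congr rfl fun k _ => toLin_decompose (g k).2 (p k) 0
    _ = decompose (regular 𝒜).deg (∑ k, toLin (g k).2 (p k)) 0 := by
      rw [decompose_sum, DFinsupp.finsetSum_apply, AddSubmonoidClass.coe_finsetSum]
    _ = one := by
      rw [hgp]
      exact decompose_of_mem_same (M := regular 𝒜) (regular 𝒜).deg (SetLike.one_mem_graded 𝒜)
  refine ⟨n, fun k => (g k).1, fun k => ofLin (N := P.shift (g k).1) (eltLin (p₀ k))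
    fun γ a ha => ?_, fun k => (g k).2, hom_ext <| LinearMap.ext fun (a : A) => ?_⟩
  · have := P.smul_mem ha (hp₀ k)
    rwa [show 0 + (g k).1 + γ = γ + (g k).1 by abel] at this
  · refine (toLin_sum_apply _ _ _).trans ?_
    refine (Finset.sum_congr rfl fun k _ => map_smul (toLin (g k).2) (op a) (p₀ k)).trans ?_
    rw [← Finset.smul_sum, hgp₀]
    exact one_mul a

theorem isGradedGenerator_of_hasFullTrace {P : GrMod 𝒜} [Module.Finite Aᵐᵒᵖ P]
    (hP : HasFullTrace A P) : IsGradedGenerator P := by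
  obtain ⟨n, p, θ, hθ⟩ := hP
  refine fun M N f hf => by_contra fun hzero => hf (hom_ext <| linearMap_ext_homogeneous ?_)
  push Not at hzero
  intro γ m hm
  let e : regular 𝒜 →ₗ[Aᵐᵒᵖ] N := (toLin f).comp (eltLin m)
  have hker (g : P →ₗ[Aᵐᵒᵖ] regular 𝒜) (q : P) : e (g q) = 0 := by
    obtain ⟨s, hs⟩ := exists_eq_sum_homComponent g
    rw [hs, LinearMap.sum_apply, map_sum]
    refine Finset.sum_eq_zero fun δ _ => ?_
    let h : P.shift (-(δ + γ)) ⟶ M := ofLin (M := P.shift (-(δ + γ)))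
      ((eltLin m).comp (homComponent δ g)) fun β q hq => by
        have := M.smul_mem (homComponent_mem_homDeg δ g _ q hq) hm
        rwa [show γ + (β + -(δ + γ) + δ) = β by abel] at this
    exact LinearMap.congr_fun (congrArg toLin (hzero _ h)) q
  calc toLin f m = e (1 : A) := by
        change _ = toLin f (op (1 : A) • m)
        rw [op_one, one_smul]
    _ = ∑ i, e (θ i (p i)) := by
        rw [← hθ]
        exact map_sum e _ _
    _ = 0 := Finset.sum_eq_zero fun i _ => hker (θ i) (p i)

instance : (forgetGrading 𝒜).Additive := ⟨rfl⟩

theorem IsGradedGenerator.hasFullTrace {P : GrMod 𝒜} (hP : IsGradedGenerator P) :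
    HasFullTrace A P :=
  (hP.isSumRetract_regular.map (forgetGrading 𝒜) (Y' := fun _ => ModuleCat.of Aᵐᵒᵖ P)
    fun _ => Iso.refl _).hasFullTrace

theorem hasDualBasis_of_isSumRetract {P : GrMod 𝒜}
    (hP : IsSumRetract (fun α => (regular 𝒜).shift α) P) : HasDualBasis A P :=
  (hP.map (forgetGrading 𝒜) (Y' := fun _ => ModuleCat.of Aᵐᵒᵖ A) fun _ => Iso.refl _).hasDualBasis

theorem isGradedProgenerator_of_isSumRetract {P : GrMod 𝒜}
    (hP : IsSumRetract (fun α => (regular 𝒜).shift α) P) (htr : HasFullTrace A P) :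
    IsGradedProgenerator P :=
  have hfin := (hasDualBasis_of_isSumRetract hP).finite
  ⟨hfin, hP.projective projective_shift_regular, isGradedGenerator_of_hasFullTrace htr⟩

end Progenerators

/-! ### Shifts and tensor products -/

section Shifts

variable {Γ : Type w} [AddCommGroup Γ] [DecidableEq Γ] {A : Type u} [Ring A]
  {𝒜 : Γ → AddSubgroup A}

theorem GrMod.mk_eq (M : GrMod 𝒜) {G : Γ → AddSubgroup M} (hG : G = M.deg)
    (h : DirectSum.IsInternal G)
    (h' : ∀ {α γ : Γ} {a : A} {m : M}, a ∈ 𝒜 α → m ∈ G γ → op a • m ∈ G (γ + α)) :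
    (⟨M, G, h, h'⟩ : GrMod 𝒜) = M := by
  subst hG; rfl

theorem GrMod.toLin_eqToHom (M : GrMod 𝒜) {G : Γ → AddSubgroup M} (hG : G = M.deg)
    (h : DirectSum.IsInternal G)
    (h' : ∀ {α γ : Γ} {a : A} {m : M}, a ∈ 𝒜 α → m ∈ G γ → op a • m ∈ G (γ + α))
    (e : (⟨M, G, h, h'⟩ : GrMod 𝒜) = M) :
    toLin (eqToHom e) = (LinearMap.id : M →ₗ[Aᵐᵒᵖ] M) := by
  subst hG; rfl

theorem GrMod.hom_eq (M N : GrMod 𝒜) {G : Γ → AddSubgroup M} (hG : G = M.deg)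
    {H : Γ → AddSubgroup N} (hH : H = N.deg) {hM : DirectSum.IsInternal G}
    {hM' : ∀ {α γ : Γ} {a : A} {m : M}, a ∈ 𝒜 α → m ∈ G γ → op a • m ∈ G (γ + α)}
    {hN : DirectSum.IsInternal H}
    {hN' : ∀ {α γ : Γ} {a : A} {m : N}, a ∈ 𝒜 α → m ∈ H γ → op a • m ∈ H (γ + α)}
    (eM : (⟨M, G, hM, hM'⟩ : GrMod 𝒜) = M) (eN : (⟨N, H, hN, hN'⟩ : GrMod 𝒜) = N)
    (f : (⟨M, G, hM, hM'⟩ : GrMod 𝒜) ⟶ ⟨N, H, hN, hN'⟩) (g : M ⟶ N)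
    (h : (f.1 : M →ₗ[Aᵐᵒᵖ] N) = toLin g) :
    f = eqToHom eM ≫ g ≫ eqToHom eN.symm := by
  subst hG hH
  exact GrMod.hom_ext h

theorem GrMod.shift_zero (M : GrMod 𝒜) : M.shift 0 = M :=
  M.mk_eq (funext fun γ => congrArg M.deg (add_zero γ)) (M.shift 0).isInternal (M.shift 0).smul_mem

theorem GrMod.toLin_eqToHom_shift_zero (M : GrMod 𝒜) (e : M.shift 0 = M) :
    toLin (eqToHom e) = (LinearMap.id : M →ₗ[Aᵐᵒᵖ] M) :=
  M.toLin_eqToHom (funext fun γ => congrArg M.deg (add_zero γ)) (M.shift 0).isInternal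
    (M.shift 0).smul_mem e

theorem GrMod.shift_shift (M : GrMod 𝒜) (α β : Γ) : (M.shift α).shift β = M.shift (α + β) :=
  (M.shift (α + β)).mk_eq
    (funext fun γ => by change M.deg _ = M.deg _; rw [add_assoc, add_comm β α])
    ((M.shift α).shift β).isInternal ((M.shift α).shift β).smul_mem

theorem GrMod.toLin_eqToHom_shift_shift (M : GrMod 𝒜) (α β : Γ)
    (e : (M.shift α).shift β = M.shift (α + β)) :
    toLin (eqToHom e) = (LinearMap.id : M →ₗ[Aᵐᵒᵖ] M) :=
  (M.shift (α + β)).toLin_eqToHom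
    (funext fun γ => by change M.deg _ = M.deg _; rw [add_assoc, add_comm β α])
    ((M.shift α).shift β).isInternal ((M.shift α).shift β).smul_mem e

end Shifts

section Tensor

variable {A B : Type*} [Ring A] [Ring B] {M : Type*} [AddCommGroup M] [Module Aᵐᵒᵖ M]
  {Q : Type*} [AddCommGroup Q] [Module A Q] [Module Bᵐᵒᵖ Q]

theorem Tens.linearMap_ext {T : Type*} [AddCommGroup T] [Module Bᵐᵒᵖ T]
    {f g : Tens A B M Q →ₗ[Bᵐᵒᵖ] T}
    (h : ∀ m q, f (Tens.tmul A B m q) = g (Tens.tmul A B m q)) : f = g :=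
  LinearMap.ext fun x => Tens.induction (p := fun x => f x = g x) (by simp) h
    (fun x y hx hy => by rw [map_add, map_add, hx, hy]) x

variable (A B M Q) in
/-- The linear map `q ↦ m ⊗ q`, additive in `m`. -/
noncomputable def Tens.mk : M →+ Q →ₗ[Bᵐᵒᵖ] Tens A B M Q :=
  AddMonoidHom.mk' (fun m =>
    { toFun := fun q => Tens.tmul A B m q
      map_add' := Tens.tmul_add A B M Q m
      map_smul' := fun _ _ => rfl })
    fun m m' => LinearMap.ext fun q => Tens.add_tmul A B M Q m m' q

@[simp] theorem Tens.mk_apply (m : M) (q : Q) : Tens.mk A B M Q m q = Tens.tmul A B m q := rfl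

variable (A B) in
@[simp] theorem Tens.zero_tmul (q : Q) : Tens.tmul A B (0 : M) q = 0 :=
  LinearMap.congr_fun (map_zero (Tens.mk A B M Q)) q

variable (A B) in
theorem Tens.sum_tmul {n : ℕ} (m : Fin n → M) (q : Q) :
    Tens.tmul A B (∑ i, m i) q = ∑ i, Tens.tmul A B (m i) q := by
  simp only [← Tens.mk_apply, map_sum, LinearMap.sum_apply]

variable (A B) in
theorem Tens.tmul_sum {n : ℕ} (m : M) (q : Fin n → Q) :
    Tens.tmul A B m (∑ i, q i) = ∑ i, Tens.tmul A B m (q i) :=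
  map_sum (Tens.mk A B M Q m) q _

variable [SMulCommClass A Bᵐᵒᵖ Q]

/-- The additive map out of `M ⊗_A Q` induced by a balanced biadditive map. -/
noncomputable def Tens.lift {T : Type*} [AddCommGroup T] (f : M →+ Q →+ T)
    (hf : ∀ (m : M) (a : A) (q : Q), f (op a • m) q = f m (a • q)) : Tens A B M Q →+ T :=
  (Tens.exists_lift B f hf).choose

@[simp] theorem Tens.lift_tmul {T : Type*} [AddCommGroup T] (f : M →+ Q →+ T)
    (hf : ∀ (m : M) (a : A) (q : Q), f (op a • m) q = f m (a • q)) (m : M) (q : Q) :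
    Tens.lift (B := B) f hf (Tens.tmul A B m q) = f m q :=
  (Tens.exists_lift B f hf).choose_spec m q

/-- The linear map out of `M ⊗_A Q` induced by a balanced map that is linear in `Q`. -/
noncomputable def Tens.liftLin {T : Type*} [AddCommGroup T] [Module Bᵐᵒᵖ T]
    (f : M →+ Q →ₗ[Bᵐᵒᵖ] T) (hf : ∀ (m : M) (a : A) (q : Q), f (op a • m) q = f m (a • q)) :
    Tens A B M Q →ₗ[Bᵐᵒᵖ] T :=
  let g := Tens.lift (B := B) (LinearMap.toAddMonoidHom'.comp f) hf
  { g with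
    map_smul' := fun b x => by
      have hg m q : g (Tens.tmul A B m q) = f m q := Tens.lift_tmul (B := B) _ hf m q
      refine Tens.induction (p := fun x => g (b • x) = b • g x) ?_ (fun m q => ?_)
        (fun x y hx hy => ?_) x
      · rw [smul_zero, map_zero, smul_zero]
      · rw [← op_unop b, Tens.op_smul_tmul, hg, hg]
        exact map_smul (f m) _ q
      · rw [smul_add, map_add, hx, hy, map_add, smul_add] }

@[simp] theorem Tens.liftLin_tmul {T : Type*} [AddCommGroup T] [Module Bᵐᵒᵖ T]
    (f : M →+ Q →ₗ[Bᵐᵒᵖ] T) (hf : ∀ (m : M) (a : A) (q : Q), f (op a • m) q = f m (a • q))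
    (m : M) (q : Q) : Tens.liftLin f hf (Tens.tmul A B m q) = f m q :=
  Tens.lift_tmul (B := B) (LinearMap.toAddMonoidHom'.comp f) hf m q

end Tensor

section GradedTensor

variable {Γ : Type w} [AddCommGroup Γ] {A B : Type u} [Ring A] [Ring B]
  {𝒜 : Γ → AddSubgroup A} {ℬ : Γ → AddSubgroup B}

theorem tensGrading_shift {M Q : Type*} [AddCommGroup M] [Module Aᵐᵒᵖ M] [AddCommGroup Q]
    [Module A Q] [Module Bᵐᵒᵖ Q] (ℳ : Γ → AddSubgroup M) (𝒬 : Γ → AddSubgroup Q) (α : Γ) :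
    tensGrading (A := A) (B := B) (fun γ => ℳ (γ + α)) 𝒬
      = fun γ => tensGrading (A := A) (B := B) ℳ 𝒬 (γ + α) := by
  funext γ
  unfold tensGrading
  congr 1
  ext x
  constructor
  · rintro ⟨i, j, rfl, m, hm, q, hq, rfl⟩
    exact ⟨i + α, j, by abel, m, hm, q, hq, rfl⟩
  · rintro ⟨i, j, hij, m, hm, q, hq, rfl⟩
    exact ⟨i - α, j, by rw [sub_add_eq_add_sub, hij, add_sub_cancel_right], m,
      by simpa using hm, q, hq, rfl⟩

variable [DecidableEq Γ]

theorem GrBimod.tensor_additive (Q : GrBimod 𝒜 ℬ) : Q.tensor.Additive where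
  map_add {M N f g} := ModuleCat.hom_ext (Tens.linearMap_ext fun m q => by
    change Tens.tmul A B (f.hom m + g.hom m) q = _
    rw [Tens.add_tmul]
    rfl)

variable [GradedRing 𝒜]

theorem GrBimod.tensorObj_shift (Q : GrBimod 𝒜 ℬ) (M : GrMod 𝒜) (α : Γ) :
    Q.tensorObj (M.shift α) = (Q.tensorObj M).shift α :=
  ((Q.tensorObj M).shift α).mk_eq (tensGrading_shift M.deg Q.deg α)
    (Q.tensorObj (M.shift α)).isInternal (Q.tensorObj (M.shift α)).smul_mem

theorem GrBimod.isGradedFunctor (Q : GrBimod 𝒜 ℬ) : IsGradedFunctor Q.grTensor := by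
  refine ⟨⟨fun {M N f g} => GrMod.hom_ext (Tens.linearMap_ext fun m q => ?_)⟩, fun α => ?_⟩
  · change Tens.tmul A B ((GrMod.toLin f + GrMod.toLin g) m) q = _
    rw [LinearMap.add_apply, Tens.add_tmul]
    rfl
  · exact CategoryTheory.Functor.ext (fun M => Q.tensorObj_shift M α) fun M N f =>
      GrMod.hom_eq ((Q.tensorObj M).shift α) ((Q.tensorObj N).shift α)
        (tensGrading_shift M.deg Q.deg α) (tensGrading_shift N.deg Q.deg α)
        (hM' := (Q.tensorObj (M.shift α)).smul_mem) (hN' := (Q.tensorObj (N.shift α)).smul_mem)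
        (Q.tensorObj_shift M α) (Q.tensorObj_shift N α) _ _ rfl

theorem GrBimod.isAssociated (Q : GrBimod 𝒜 ℬ) : IsAssociated Q.grTensor Q.tensor :=
  ⟨Q.isGradedFunctor, rfl⟩

end GradedTensor

/-! ### Invertible bimodules -/

section Hom

variable {A B : Type*} [Ring A] [Ring B] {Q : Type*} [AddCommGroup Q] [Module A Q]
  [Module Bᵐᵒᵖ Q] [SMulCommClass A Bᵐᵒᵖ Q] {N : Type*} [AddCommGroup N] [Module Bᵐᵒᵖ N]

/-- The right `A`-module structure `(f a)(q) = f (a q)` on `Hom_B(Q, N)`. -/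
scoped instance homModule : Module Aᵐᵒᵖ (Q →ₗ[Bᵐᵒᵖ] N) :=
  have := SMulCommClass.symm A Bᵐᵒᵖ Q
  inferInstanceAs (Module Aᵈᵐᵃ (Q →ₗ[Bᵐᵒᵖ] N))

theorem op_smul_linearMap_apply (a : A) (f : Q →ₗ[Bᵐᵒᵖ] N) (q : Q) : (op a • f) q = f (a • q) :=
  rfl

variable (A B Q N) in
/-- The evaluation map `Hom_B(Q, N) ⊗_A Q → N`. -/
noncomputable def homCounit : Tens A B (Q →ₗ[Bᵐᵒᵖ] N) Q →ₗ[Bᵐᵒᵖ] N :=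
  Tens.liftLin (AddMonoidHom.id _) fun _ _ _ => rfl

@[simp] theorem homCounit_tmul (f : Q →ₗ[Bᵐᵒᵖ] N) (q : Q) :
    homCounit A B Q N (Tens.tmul A B f q) = f q :=
  Tens.liftLin_tmul _ _ f q

variable {N' : Type*} [AddCommGroup N'] [Module Bᵐᵒᵖ N']

variable (A Q) in
/-- Composition with a `B`-linear map, as an `A`-linear map between the modules `Hom_B(Q, -)`. -/
def homMap (f : N →ₗ[Bᵐᵒᵖ] N') : (Q →ₗ[Bᵐᵒᵖ] N) →ₗ[Aᵐᵒᵖ] (Q →ₗ[Bᵐᵒᵖ] N') where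
  toFun g := f.comp g
  map_add' g g' := LinearMap.comp_add g g' f
  map_smul' _ _ := rfl

theorem homCounit_map_homMap (f : N →ₗ[Bᵐᵒᵖ] N') (x : Tens A B (Q →ₗ[Bᵐᵒᵖ] N) Q) :
    homCounit A B Q N' (Tens.map B Q (homMap A Q f) x) = f (homCounit A B Q N x) := by
  refine LinearMap.congr_fun (f := (homCounit A B Q N').comp (Tens.map B Q (homMap A Q f)))
    (g := f.comp (homCounit A B Q N)) (Tens.linearMap_ext fun g q => ?_) x
  rw [LinearMap.comp_apply, LinearMap.comp_apply, Tens.map_tmul, homCounit_tmul, homCounit_tmul]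
  rfl

/-- For `ξ : Q → B`, the map sending `y` to `q ↦ y ξ(q)`, additive in `y`. -/
def smulRightHom (ξ : Q →ₗ[Bᵐᵒᵖ] B) : N →+ (Q →ₗ[Bᵐᵒᵖ] N) :=
  AddMonoidHom.mk' (fun y => (eltLin y).comp ξ) fun y y' =>
    LinearMap.ext fun q => smul_add (op (ξ q)) y y'

@[simp] theorem smulRightHom_apply (ξ : Q →ₗ[Bᵐᵒᵖ] B) (y : N) (q : Q) :
    smulRightHom ξ y q = op (ξ q) • y :=
  rfl

variable {M : Type*} [AddCommGroup M] [Module Aᵐᵒᵖ M]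

variable (A B Q M) in
/-- The map `M → Hom_B(Q, M ⊗_A Q)`, `m ↦ (q ↦ m ⊗ q)`. -/
noncomputable def homUnit : M →ₗ[Aᵐᵒᵖ] (Q →ₗ[Bᵐᵒᵖ] Tens A B M Q) :=
  { Tens.mk A B M Q with
    map_smul' := fun a m => LinearMap.ext fun q => Tens.smul_tmul A B M Q m (unop a) q }

theorem homUnit_apply (m : M) (q : Q) : homUnit A B Q M m q = Tens.tmul A B m q :=
  rfl

variable (A B Q) in
/-- The bimodule `Q` induces a Morita equivalence: it is a progenerator over `B`, and `A` acts on
it as its full ring of `B`-linear endomorphisms. -/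
structure IsInvertibleBimodule : Prop where
  bijective : Function.Bijective (Module.toModuleEnd Bᵐᵒᵖ Q : A →+* Module.End Bᵐᵒᵖ Q)
  hasDualBasis : HasDualBasis B Q
  hasFullTrace : HasFullTrace B Q

namespace IsInvertibleBimodule

variable (h : IsInvertibleBimodule A B Q)
include h

theorem eq_of_smul_eq {a a' : A} (haa' : ∀ q : Q, a • q = a' • q) : a = a' :=
  h.bijective.1 <| LinearMap.ext haa'

/-- For `ξ : Q → B`, the map sending `q` to the element of `A` that acts as `q' ↦ q ξ(q')`. -/
noncomputable def rankOne (ξ : Q →ₗ[Bᵐᵒᵖ] B) : Q →+ A :=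
  (RingEquiv.ofBijective _ h.bijective).symm.toAddMonoidHom.comp (smulRightHom ξ)

theorem rankOne_smul (ξ : Q →ₗ[Bᵐᵒᵖ] B) (q q' : Q) : h.rankOne ξ q • q' = op (ξ q') • q :=
  LinearMap.congr_fun ((RingEquiv.ofBijective _ h.bijective).apply_symm_apply _) q'

theorem rankOne_smul_left (ξ : Q →ₗ[Bᵐᵒᵖ] B) (a : A) (q : Q) :
    h.rankOne ξ (a • q) = a * h.rankOne ξ q :=
  h.eq_of_smul_eq fun q' => by
    rw [rankOne_smul, mul_smul, rankOne_smul, smul_comm a (op (ξ q')) q]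

theorem homCounit_bijective : Function.Bijective (homCounit A B Q N) := by
  obtain ⟨n, p, θ, hθ⟩ := h.hasFullTrace
  have hop : ∑ k, op (θ k (p k)) = 1 := by rw [← Finset.op_sum, hθ, op_one]
  let inv : N →+ Tens A B (Q →ₗ[Bᵐᵒᵖ] N) Q :=
    AddMonoidHom.mk' (fun y => ∑ k, Tens.tmul A B (smulRightHom (θ k) y) (p k)) fun y y' => by
      simp only [map_add, Tens.add_tmul, Finset.sum_add_distrib]
  have inv_apply (f : Q →ₗ[Bᵐᵒᵖ] N) (q : Q) : inv (f q) = Tens.tmul A B f q := by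
    have hq : ∑ k, h.rankOne (θ k) q • p k = q := by
      simp only [rankOne_smul, ← Finset.sum_smul, hop, one_smul]
    have hf k : smulRightHom (θ k) (f q) = op (h.rankOne (θ k) q) • f :=
      LinearMap.ext fun q' => by
        rw [op_smul_linearMap_apply, rankOne_smul, map_smul, smulRightHom_apply]
    calc ∑ k, Tens.tmul A B (smulRightHom (θ k) (f q)) (p k)
        = ∑ k, Tens.tmul A B f (h.rankOne (θ k) q • p k) :=
          Finset.sum_congr rfl fun k _ => by rw [hf, Tens.smul_tmul]
      _ = Tens.tmul A B f q := by rw [← Tens.tmul_sum, hq]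
  refine Function.bijective_iff_has_inverse.2 ⟨inv, fun x => ?_, fun y => ?_⟩
  · refine Tens.induction (p := fun x => inv (homCounit A B Q N x) = x) ?_ (fun f q => ?_)
      (fun x x' hx hx' => ?_) x
    · rw [map_zero, map_zero]
    · rw [homCounit_tmul, inv_apply]
    · rw [map_add, map_add, hx, hx']
  · simp only [inv, AddMonoidHom.mk'_apply, map_sum, homCounit_tmul, smulRightHom_apply,
      ← Finset.sum_smul, hop, one_smul]

variable (M) in
/-- The map `M ⊗_A Q → M`, `m ⊗ q ↦ m a`, where `a` acts on `Q` as `q' ↦ q ξ(q')`. -/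
noncomputable def contract (ξ : Q →ₗ[Bᵐᵒᵖ] B) : Tens A B M Q →+ M :=
  Tens.lift (AddMonoidHom.mk'
    (fun m => AddMonoidHom.mk' (fun q => op (h.rankOne ξ q) • m) fun q q' => by
      rw [map_add, MulOpposite.op_add, add_smul])
    fun m m' => AddMonoidHom.ext fun q => smul_add (op (h.rankOne ξ q)) m m')
    fun m a q => by
      simp only [AddMonoidHom.mk'_apply, rankOne_smul_left, op_mul, mul_smul]

theorem contract_tmul (ξ : Q →ₗ[Bᵐᵒᵖ] B) (m : M) (q : Q) :
    h.contract M ξ (Tens.tmul A B m q) = op (h.rankOne ξ q) • m :=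
  Tens.lift_tmul _ _ m q

theorem contract_tmul_right (ξ : Q →ₗ[Bᵐᵒᵖ] B) (t : Tens A B M Q) (q : Q) :
    Tens.tmul A B (h.contract M ξ t) q = op (ξ q) • t := by
  refine Tens.induction (p := fun t => Tens.tmul A B (h.contract M ξ t) q = op (ξ q) • t) ?_
    (fun m q' => ?_) (fun t t' ht ht' => ?_) t
  · rw [map_zero, Tens.zero_tmul, smul_zero]
  · rw [contract_tmul, Tens.smul_tmul, rankOne_smul, Tens.op_smul_tmul]
  · rw [map_add, Tens.add_tmul, ht, ht', smul_add]

theorem homUnit_bijective : Function.Bijective (homUnit A B Q M) := by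
  obtain ⟨n, x, ξ, hx⟩ := h.hasDualBasis
  refine ⟨(injective_iff_map_eq_zero _).2 fun m hm => ?_, fun g =>
    ⟨∑ i, h.contract M (ξ i) (g (x i)), LinearMap.ext fun q => ?_⟩⟩
  · have hone : ∑ i, h.rankOne (ξ i) (x i) = 1 := h.eq_of_smul_eq fun q => by
      rw [Finset.sum_smul, one_smul]
      simpa only [rankOne_smul] using hx q
    have hzero i : op (h.rankOne (ξ i) (x i)) • m = 0 := by
      rw [← contract_tmul, ← homUnit_apply, hm, LinearMap.zero_apply, map_zero]
    rw [← one_smul Aᵐᵒᵖ m, ← op_one, ← hone, Finset.op_sum, Finset.sum_smul]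
    exact Finset.sum_eq_zero fun i _ => hzero i
  · rw [homUnit_apply, Tens.sum_tmul]
    conv_rhs => rw [← hx q, map_sum]
    exact Finset.sum_congr rfl fun i _ => by rw [contract_tmul_right, map_smul]

end IsInvertibleBimodule

end Hom

/-! ### Hom functors of invertible bimodules -/

section HomFunctor

variable {Γ : Type w} [AddCommGroup Γ] [DecidableEq Γ] {A B : Type u} [Ring A] [Ring B]
  {𝒜 : Γ → AddSubgroup A} {ℬ : Γ → AddSubgroup B}

namespace GrBimod

/-- The graded right module underlying a graded bimodule. -/
def toGrMod (Q : GrBimod 𝒜 ℬ) : GrMod ℬ where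
  carrier := Q
  deg := Q.deg
  isInternal := Q.isInternal
  smul_mem := Q.right_smul_mem

/-- The functor `Hom_B(Q, -) : Mod-B ⥤ Mod-A`. -/
def hom (Q : GrBimod 𝒜 ℬ) : ModuleCat.{u} Bᵐᵒᵖ ⥤ ModuleCat.{u} Aᵐᵒᵖ where
  obj N := ModuleCat.of Aᵐᵒᵖ (Q →ₗ[Bᵐᵒᵖ] N)
  map f := ModuleCat.ofHom (homMap A Q f.hom)

theorem isEquivalence_tensor {Q : GrBimod 𝒜 ℬ} (hQ : IsInvertibleBimodule A B Q) :
    Q.tensor.IsEquivalence := by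
  let unit : 𝟭 _ ≅ Q.tensor ⋙ Q.hom := NatIso.ofComponents
    (fun M => (LinearEquiv.ofBijective _ (hQ.homUnit_bijective (M := M))).toModuleIso)
    fun _ => rfl
  let counit : Q.hom ⋙ Q.tensor ≅ 𝟭 _ := NatIso.ofComponents
    (fun N => (LinearEquiv.ofBijective _ (hQ.homCounit_bijective (N := N))).toModuleIso)
    fun f => ModuleCat.hom_ext <| LinearMap.ext (homCounit_map_homMap f.hom)
  exact (CategoryTheory.Equivalence.mk Q.tensor Q.hom unit counit).isEquivalence_functor

theorem isGradedModEquivalence_tensor [GradedRing 𝒜] {Q : GrBimod 𝒜 ℬ}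
    (hQ : IsInvertibleBimodule A B Q) :
    IsGradedModEquivalence 𝒜 ℬ Q.tensor :=
  ⟨Q.tensor_additive, isEquivalence_tensor hQ, Q.grTensor, Q.isAssociated⟩

variable [GradedRing ℬ]

/-- The graded right `A`-module `Hom_B(Q, N)`. -/
def homObj (Q : GrBimod 𝒜 ℬ) [Module.Finite Bᵐᵒᵖ Q] (N : GrMod ℬ) : GrMod 𝒜 where
  carrier := Q →ₗ[Bᵐᵒᵖ] N
  deg := homDeg Q.toGrMod N
  isInternal := have : Module.Finite Bᵐᵒᵖ Q.toGrMod := ‹_›; GrMod.isInternal_homDeg Q.toGrMod N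
  smul_mem {α γ a f} ha hf β q hq := by
    have := hf _ _ (Q.left_smul_mem ha hq)
    rwa [show α + β + γ = β + (γ + α) by abel] at this

/-- The functor `Hom_B(Q, -) : Gr-B ⥤ Gr-A`. -/
def grHom (Q : GrBimod 𝒜 ℬ) [Module.Finite Bᵐᵒᵖ Q] : GrMod ℬ ⥤ GrMod 𝒜 where
  obj N := Q.homObj N
  map {N N'} f := GrMod.ofLin (M := Q.homObj N) (N := Q.homObj N') (homMap A Q (GrMod.toLin f))
    fun _ _ hg β q hq => GrMod.toLin_mem f (hg β q hq)

theorem isGradedFunctor_grHom (Q : GrBimod 𝒜 ℬ) [Module.Finite Bᵐᵒᵖ Q] :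
    IsGradedFunctor Q.grHom := by
  refine ⟨⟨fun {_ _ _ _} => rfl⟩, fun α => ?_⟩
  have hdeg (N : GrMod ℬ) : (Q.homObj (N.shift α)).deg = ((Q.homObj N).shift α).deg := by
    funext γ
    ext (f : Q →ₗ[Bᵐᵒᵖ] N)
    exact forall₃_congr fun β q _ => by
      change f q ∈ N.deg (β + γ + α) ↔ f q ∈ N.deg (β + (γ + α))
      rw [add_assoc]
  have hobj (N : GrMod ℬ) : Q.homObj (N.shift α) = (Q.homObj N).shift α :=
    ((Q.homObj N).shift α).mk_eq (hdeg N) (Q.homObj (N.shift α)).isInternal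
      (Q.homObj (N.shift α)).smul_mem
  exact CategoryTheory.Functor.ext hobj fun N N' f =>
    GrMod.hom_eq ((Q.homObj N).shift α) ((Q.homObj N').shift α) (hdeg N) (hdeg N')
      (hM' := (Q.homObj (N.shift α)).smul_mem) (hN' := (Q.homObj (N'.shift α)).smul_mem)
      (hobj N) (hobj N') _ _ rfl

variable [GradedRing 𝒜] {Q : GrBimod 𝒜 ℬ} [Module.Finite Bᵐᵒᵖ Q]

/-- The isomorphism `1 ≅ Hom_B(Q, - ⊗_A Q)` of functors `Gr-A ⥤ Gr-A`. -/
noncomputable def grUnitIso (hQ : IsInvertibleBimodule A B Q) : 𝟭 _ ≅ Q.grTensor ⋙ Q.grHom :=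
  NatIso.ofComponents (fun M => GrMod.isoOfBijective
    (GrMod.ofLin (N := Q.homObj (Q.tensorObj M)) (homUnit A B Q M) fun γ m hm β q hq =>
      AddSubgroup.subset_closure ⟨γ, β, add_comm γ β, m, hm, q, hq, rfl⟩)
    hQ.homUnit_bijective) fun _ => rfl

theorem homCounit_mem {N : GrMod ℬ} {γ : Γ} {x : Tens A B (Q →ₗ[Bᵐᵒᵖ] N) Q}
    (hx : x ∈ (Q.tensorObj (Q.homObj N)).deg γ) : homCounit A B Q N x ∈ N.deg γ := by
  refine (AddSubgroup.closure_le ((N.deg γ).comap (homCounit A B Q N).toAddMonoidHom)).2 ?_ hx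
  rintro _ ⟨i, j, rfl, (f : Q →ₗ[Bᵐᵒᵖ] N), hf, q, hq, rfl⟩
  change homCounit A B Q N (Tens.tmul A B f q) ∈ N.deg (i + j)
  rw [homCounit_tmul, add_comm]
  exact hf j q hq

/-- The isomorphism `Hom_B(Q, -) ⊗_A Q ≅ 1` of functors `Gr-B ⥤ Gr-B`. -/
noncomputable def grCounitIso (hQ : IsInvertibleBimodule A B Q) : Q.grHom ⋙ Q.grTensor ≅ 𝟭 _ :=
  NatIso.ofComponents (fun N => GrMod.isoOfBijective
    (GrMod.ofLin (M := Q.tensorObj (Q.homObj N)) (homCounit A B Q N) fun _ _ => homCounit_mem)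
    hQ.homCounit_bijective)
    fun f => GrMod.hom_ext <| LinearMap.ext (homCounit_map_homMap (GrMod.toLin f))

theorem isGradedEquivalence_grTensor {Q : GrBimod 𝒜 ℬ} (hQ : IsInvertibleBimodule A B Q) :
    IsGradedEquivalence Q.grTensor := by
  have := hQ.hasDualBasis.finite
  exact ⟨Q.isGradedFunctor, Q.grHom, Q.isGradedFunctor_grHom, ⟨(grUnitIso hQ).symm⟩,
    ⟨grCounitIso hQ⟩⟩

end GrBimod

end HomFunctor

/-! ### Graded functors -/

section GradedFunctor

open GrMod

variable {Γ : Type w} [AddCommGroup Γ] [DecidableEq Γ] {A B : Type u} [Ring A] [Ring B]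
  {𝒜 : Γ → AddSubgroup A} {ℬ : Γ → AddSubgroup B} {φ : GrMod 𝒜 ⥤ GrMod ℬ}

/-- The shift of a morphism. -/
def GrMod.shiftMap (γ : Γ) {M N : GrMod 𝒜} (f : M ⟶ N) : M.shift γ ⟶ N.shift γ :=
  (suspension 𝒜 γ).map f

/-- The linear map underlying a morphism to a shift. -/
def GrMod.toDeg {M N : GrMod 𝒜} {γ : Γ} (f : M ⟶ N.shift γ) : M →ₗ[Aᵐᵒᵖ] N :=
  toLin (N := N.shift γ) f

theorem GrMod.toDeg_mem {M N : GrMod 𝒜} {γ : Γ} (f : M ⟶ N.shift γ) :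
    toDeg f ∈ homDeg M N γ :=
  fun _ _ hm => toLin_mem (N := N.shift γ) f hm

theorem GrMod.toDeg_injective {M N : GrMod 𝒜} {γ : Γ} {f g : M ⟶ N.shift γ}
    (h : toDeg f = toDeg g) : f = g :=
  hom_ext h

theorem GrMod.shiftMap_comp {L M N : GrMod 𝒜} (γ : Γ) (f : L ⟶ M) (g : M ⟶ N) :
    shiftMap γ (f ≫ g) = shiftMap γ f ≫ shiftMap γ g := rfl

theorem GrMod.shiftMap_eqToHom {M N : GrMod 𝒜} (γ : Γ) (h : M = N) (h' : M.shift γ = N.shift γ) :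
    shiftMap γ (eqToHom h) = eqToHom h' := by
  subst h; rfl

theorem GrMod.toDeg_comp_shift_shift {M N : GrMod 𝒜} {γ δ : Γ} (f : M ⟶ (N.shift γ).shift δ) :
    toDeg (f ≫ eqToHom (N.shift_shift γ δ)) = toDeg f := by
  have := N.toLin_eqToHom_shift_shift γ δ (N.shift_shift γ δ)
  exact congrArg (fun k : N →ₗ[Aᵐᵒᵖ] N => k.comp (toLin (N := (N.shift γ).shift δ) f)) this

theorem GrMod.toLin_comp_shift_zero {M N : GrMod 𝒜} (f : M ⟶ N.shift 0) :
    toLin (f ≫ eqToHom N.shift_zero) = toDeg f := by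
  have := N.toLin_eqToHom_shift_zero N.shift_zero
  exact congrArg (fun k : N →ₗ[Aᵐᵒᵖ] N => k.comp (toLin (N := N.shift 0) f)) this

namespace IsGradedFunctor

theorem obj_shift (hφ : IsGradedFunctor φ) (M : GrMod 𝒜) (γ : Γ) :
    φ.obj (M.shift γ) = (φ.obj M).shift γ :=
  Functor.congr_obj (hφ.2 γ) M

theorem map_shiftMap (hφ : IsGradedFunctor φ) {M N : GrMod 𝒜} (f : M ⟶ N) (γ : Γ) :
    φ.map (shiftMap γ f) = eqToHom (hφ.obj_shift M γ) ≫ shiftMap γ (φ.map f)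
      ≫ eqToHom (hφ.obj_shift N γ).symm :=
  Functor.congr_hom (hφ.2 γ) f

/-- The action of a graded functor on morphisms to a shift. -/
def mapShift (hφ : IsGradedFunctor φ) {M N : GrMod 𝒜} {γ : Γ} (f : M ⟶ N.shift γ) :
    φ.obj M ⟶ (φ.obj N).shift γ :=
  φ.map f ≫ eqToHom (hφ.obj_shift N γ)

theorem mapShift_comp_shiftMap (hφ : IsGradedFunctor φ) {L M N : GrMod 𝒜} {γ : Γ}
    (g : L ⟶ M.shift γ) (f : M ⟶ N) :
    hφ.mapShift (g ≫ shiftMap γ f) = hφ.mapShift g ≫ shiftMap γ (φ.map f) := by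
  simp only [mapShift, Functor.map_comp, hφ.map_shiftMap, Category.assoc, eqToHom_trans,
    eqToHom_refl, Category.comp_id]

theorem mapShift_comp (hφ : IsGradedFunctor φ) {L M N : GrMod 𝒜} {γ δ : Γ}
    (f : L ⟶ M.shift δ) (g : M ⟶ N.shift γ) :
    hφ.mapShift (f ≫ shiftMap δ g ≫ eqToHom (N.shift_shift γ δ))
      = hφ.mapShift f ≫ shiftMap δ (hφ.mapShift g)
        ≫ eqToHom ((φ.obj N).shift_shift γ δ) := by
  simp only [mapShift, Functor.map_comp, hφ.map_shiftMap, Category.assoc, eqToHom_trans,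
    eqToHom_map, shiftMap_comp]
  rw [shiftMap_eqToHom δ (hφ.obj_shift N γ) (congrArg (GrMod.shift δ) (hφ.obj_shift N γ)),
    eqToHom_trans]

theorem mapShift_id (hφ : IsGradedFunctor φ) {M : GrMod 𝒜} (f : M ⟶ M.shift 0)
    (hf : f ≫ eqToHom M.shift_zero = 𝟙 M) :
    hφ.mapShift f ≫ eqToHom (φ.obj M).shift_zero = 𝟙 (φ.obj M) := by
  rw [← φ.map_id, ← hf, Functor.map_comp, eqToHom_map, mapShift, Category.assoc, eqToHom_trans]

/-- The action of a graded functor on linear maps of degree `γ`. -/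
def mapDeg (hφ : IsGradedFunctor φ) (M N : GrMod 𝒜) (γ : Γ) :
    homDeg M N γ →+ (φ.obj M →ₗ[Bᵐᵒᵖ] φ.obj N) :=
  AddMonoidHom.mk' (fun f => toDeg (hφ.mapShift (ofDeg f.1 f.2))) fun f g => by
    have := hφ.1
    rw [show ofDeg (f + g).1 (f + g).2 = ofDeg f.1 f.2 + ofDeg g.1 g.2 from rfl,
      mapShift, Functor.map_add, Preadditive.add_comp]
    rfl

theorem mapDeg_apply (hφ : IsGradedFunctor φ) {M N : GrMod 𝒜} {γ : Γ} (f : homDeg M N γ) :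
    hφ.mapDeg M N γ f = toDeg (hφ.mapShift (ofDeg f.1 f.2)) := rfl

theorem mapDeg_mem (hφ : IsGradedFunctor φ) {M N : GrMod 𝒜} {γ : Γ} (f : homDeg M N γ) :
    hφ.mapDeg M N γ f ∈ homDeg (φ.obj M) (φ.obj N) γ :=
  toDeg_mem _

theorem mapDeg_hom_comp (hφ : IsGradedFunctor φ) {L M N : GrMod 𝒜} {γ : Γ} (f : M ⟶ N)
    (g : homDeg L M γ) (h : homDeg L N γ) (hfg : h.1 = (toLin f).comp g.1) :
    hφ.mapDeg L N γ h = (toLin (φ.map f)).comp (hφ.mapDeg L M γ g) := by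
  have e : ofDeg h.1 h.2 = ofDeg g.1 g.2 ≫ shiftMap γ f :=
    hom_ext hfg
  rw [mapDeg_apply, e, mapShift_comp_shiftMap]
  rfl

theorem mapDeg_comp (hφ : IsGradedFunctor φ) {L M N : GrMod 𝒜} {γ δ : Γ} (g : homDeg M N γ)
    (f : homDeg L M δ) (h : homDeg L N (γ + δ)) (hfg : h.1 = g.1.comp f.1) :
    hφ.mapDeg L N (γ + δ) h = (hφ.mapDeg M N γ g).comp (hφ.mapDeg L M δ f) := by
  have e : ofDeg h.1 h.2 = ofDeg f.1 f.2 ≫ shiftMap δ (ofDeg g.1 g.2)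
      ≫ eqToHom (N.shift_shift γ δ) := by
    refine toDeg_injective ?_
    rw [← Category.assoc, toDeg_comp_shift_shift]
    exact hfg
  rw [mapDeg_apply, e, mapShift_comp, ← Category.assoc, toDeg_comp_shift_shift]
  rfl

theorem mapDeg_id (hφ : IsGradedFunctor φ) {M : GrMod 𝒜} (h : homDeg M M 0)
    (hid : h.1 = LinearMap.id) : hφ.mapDeg M M 0 h = LinearMap.id := by
  have e : ofDeg h.1 h.2 ≫ eqToHom M.shift_zero = 𝟙 M := by
    refine hom_ext ?_
    rw [toLin_comp_shift_zero]
    exact hid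
  rw [mapDeg_apply, ← toLin_comp_shift_zero, hφ.mapShift_id _ e, toLin_id]

theorem mapDeg_injective (hφ : IsGradedFunctor φ) [φ.Faithful] {M N : GrMod 𝒜} {γ : Γ}
    (f : homDeg M N γ) (hf : hφ.mapDeg M N γ f = 0) : f = 0 := by
  have h1 : hφ.mapShift (ofDeg f.1 f.2) = 0 := toDeg_injective hf
  have := hφ.1
  have h2 : ofDeg f.1 f.2 = 0 := by
    apply φ.map_injective
    rw [Functor.map_zero, ← cancel_mono (eqToHom (hφ.obj_shift N γ)), Limits.zero_comp]
    exact h1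
  exact Subtype.ext (congrArg toLin h2)

theorem mapDeg_surjective (hφ : IsGradedFunctor φ) [φ.Full] {M N : GrMod 𝒜} {γ : Γ}
    (g : φ.obj M →ₗ[Bᵐᵒᵖ] φ.obj N) (hg : g ∈ homDeg (φ.obj M) (φ.obj N) γ) :
    ∃ f, hφ.mapDeg M N γ f = g := by
  obtain ⟨f, hf⟩ := φ.map_surjective (ofDeg g hg ≫ eqToHom (hφ.obj_shift N γ).symm)
  refine ⟨⟨toDeg f, toDeg_mem f⟩, ?_⟩
  have : hφ.mapShift f = ofDeg g hg := by
    rw [mapShift, hf, Category.assoc, eqToHom_trans, eqToHom_refl, Category.comp_id]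
  exact congrArg toDeg this

variable [GradedRing 𝒜]

/-- The map `M → Hom_B(φ(A), φ(M))` given by the action of `φ` on the maps `a ↦ m a`. -/
noncomputable def eltMap (hφ : IsGradedFunctor φ) (M : GrMod 𝒜) :
    M →+ (φ.obj (regular 𝒜) →ₗ[Bᵐᵒᵖ] φ.obj M) :=
  liftComponents M.deg fun γ => (hφ.mapDeg (regular 𝒜) M γ).comp
    (AddMonoidHom.mk' (fun m => ⟨eltLin m.1, eltLin_mem_homDeg m.2⟩) fun m m' =>
      Subtype.ext (map_add (eltLinEquiv M) m.1 m'.1))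

theorem eltMap_of_mem (hφ : IsGradedFunctor φ) {M : GrMod 𝒜} {γ : Γ} {m : M} (hm : m ∈ M.deg γ) :
    hφ.eltMap M m = hφ.mapDeg (regular 𝒜) M γ ⟨eltLin m, eltLin_mem_homDeg hm⟩ :=
  liftComponents_of_mem M.deg _ hm

theorem eltMap_mem (hφ : IsGradedFunctor φ) {M : GrMod 𝒜} {γ : Γ} {m : M} (hm : m ∈ M.deg γ) :
    hφ.eltMap M m ∈ homDeg (φ.obj (regular 𝒜)) (φ.obj M) γ := by
  rw [hφ.eltMap_of_mem hm]
  exact hφ.mapDeg_mem _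

theorem eltMap_natural (hφ : IsGradedFunctor φ) {M N : GrMod 𝒜} (f : M ⟶ N) (m : M) :
    hφ.eltMap N (toLin f m) = (toLin (φ.map f)).comp (hφ.eltMap M m) := by
  induction m using DirectSum.Decomposition.inductionOn M.deg with
  | zero => simp only [map_zero, LinearMap.comp_zero]
  | @homogeneous γ m =>
    rw [hφ.eltMap_of_mem m.2, hφ.eltMap_of_mem (toLin_mem f m.2)]
    exact hφ.mapDeg_hom_comp f _ _ (LinearMap.ext fun (a : A) =>
      (map_smul (toLin f) (op a) (m : M)).symm)
  | add x y hx hy => simp only [map_add, hx, hy, LinearMap.comp_add]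

theorem eltMap_smul (hφ : IsGradedFunctor φ) {M : GrMod 𝒜} (m : M) (a : A) :
    hφ.eltMap M (op a • m) = (hφ.eltMap M m).comp (hφ.eltMap (regular 𝒜) a) := by
  let ρ : A →+ Module.End Bᵐᵒᵖ (φ.obj (regular 𝒜)) := hφ.eltMap (regular 𝒜)
  change hφ.eltMap M (op a • m) = (hφ.eltMap M m).comp (ρ a)
  induction m using DirectSum.Decomposition.inductionOn M.deg with
  | zero => rw [smul_zero, map_zero, LinearMap.zero_comp]
  | add x y hx hy => rw [smul_add, map_add, map_add, hx, hy, LinearMap.add_comp]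
  | @homogeneous γ m =>
    induction a using DirectSum.Decomposition.inductionOn 𝒜 with
    | zero => rw [op_zero, zero_smul, map_zero, map_zero, LinearMap.comp_zero]
    | add a b ha hb =>
      rw [MulOpposite.op_add, add_smul, map_add, ha, hb, map_add, LinearMap.comp_add]
    | @homogeneous α a =>
      rw [hφ.eltMap_of_mem m.2, hφ.eltMap_of_mem (M.smul_mem a.2 m.2),
        show ρ a = _ from hφ.eltMap_of_mem (M := regular 𝒜) a.2]
      refine hφ.mapDeg_comp _ _ _ (LinearMap.ext fun (x : A) => ?_)
      change op x • op (a : A) • (m : M) = op (a * x) • (m : M)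
      rw [op_mul, mul_smul]

theorem eltMap_one (hφ : IsGradedFunctor φ) : hφ.eltMap (regular 𝒜) (1 : A) = LinearMap.id :=
  (hφ.eltMap_of_mem (M := regular 𝒜) (SetLike.one_mem_graded 𝒜)).trans
    (hφ.mapDeg_id _ (LinearMap.ext fun (a : A) => one_mul a))

theorem eltMap_bijective (hφ : IsGradedFunctor φ) [GradedRing ℬ] [φ.Full] [φ.Faithful]
    [Module.Finite Bᵐᵒᵖ (φ.obj (regular 𝒜))] (M : GrMod 𝒜) :
    Function.Bijective (hφ.eltMap M) := by
  let _ := (isInternal_homDeg (φ.obj (regular 𝒜)) (φ.obj M)).chooseDecomposition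
  refine bijective_of_components (G := M.deg) (G' := homDeg (φ.obj (regular 𝒜)) (φ.obj M)) _
    Function.injective_id (fun γ m hm => hφ.eltMap_mem hm) (fun γ m hm h => ?_) fun γ g hg => ?_
  · rw [hφ.eltMap_of_mem hm] at h
    exact (eltLinEquiv M).injective <|
      (congrArg Subtype.val (hφ.mapDeg_injective _ h)).trans (map_zero (eltLinEquiv M)).symm
  · obtain ⟨f, rfl⟩ := hφ.mapDeg_surjective g hg
    have hm : f.1 (1 : A) ∈ M.deg γ := by
      have := f.2 0 (1 : A) (SetLike.one_mem_graded 𝒜)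
      rwa [zero_add] at this
    exact ⟨f.1 (1 : A), (hφ.eltMap_of_mem hm).trans
      (congrArg _ (Subtype.ext (eltLin_map_one f.1)))⟩

end IsGradedFunctor

/-- The graded bimodule given by a graded right module `Q` on which `A` acts from the left by
endomorphisms, compatibly with the gradings. -/
def GrBimod.ofEnd (Q : GrMod ℬ) (ρ : A →+* Module.End Bᵐᵒᵖ Q)
    (hρ : ∀ α, ∀ a ∈ 𝒜 α, ρ a ∈ homDeg Q Q α) : GrBimod 𝒜 ℬ :=
  letI : Module A Q := Module.compHom _ ρ
  { carrier := Q
    smulCommClass := ⟨fun a b q => map_smul (ρ a) b q⟩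
    deg := Q.deg
    isInternal := Q.isInternal
    left_smul_mem := fun {α γ a q} ha hq => by
      rw [add_comm]
      exact hρ α a ha γ q hq
    right_smul_mem := Q.smul_mem }

/-- The left action of `A` on `φ(A)`. -/
noncomputable def IsGradedFunctor.leftAction [GradedRing 𝒜] (hφ : IsGradedFunctor φ) :
    A →+* Module.End Bᵐᵒᵖ (φ.obj (regular 𝒜)) where
  toFun := hφ.eltMap (regular 𝒜)
  map_zero' := map_zero (hφ.eltMap (regular 𝒜))
  map_add' := map_add (hφ.eltMap (regular 𝒜))
  map_one' := hφ.eltMap_one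
  map_mul' := hφ.eltMap_smul (M := regular 𝒜)

/-- The graded `A`-`B`-bimodule `φ(A)`. -/
noncomputable def IsGradedFunctor.bimod [GradedRing 𝒜] (hφ : IsGradedFunctor φ) : GrBimod 𝒜 ℬ :=
  .ofEnd (φ.obj (regular 𝒜)) hφ.leftAction fun _ _ ha => hφ.eltMap_mem (M := regular 𝒜) ha

end GradedFunctor

section GradedEquivalence

open GrMod

variable {Γ : Type w} [AddCommGroup Γ] [DecidableEq Γ] {A B : Type u} [Ring A] [Ring B]
  {𝒜 : Γ → AddSubgroup A} {ℬ : Γ → AddSubgroup B} {φ : GrMod 𝒜 ⥤ GrMod ℬ}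

theorem IsGradedGenerator.map {P : GrMod 𝒜} (hP : IsGradedGenerator P) (hφ : IsGradedFunctor φ)
    [φ.IsEquivalence] : IsGradedGenerator (φ.obj P) := by
  have := hφ.1
  intro M N f hf
  let iM := φ.objObjPreimageIso M
  let iN := φ.objObjPreimageIso N
  let f' := φ.preimage (iM.hom ≫ f ≫ iN.inv)
  have hf' : φ.map f' = iM.hom ≫ f ≫ iN.inv := φ.map_preimage _
  obtain ⟨α, g, hg⟩ := hP f' fun h => hf <| by
    rw [h, Functor.map_zero, eq_comm, Preadditive.IsIso.comp_left_eq_zero,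
      Preadditive.IsIso.comp_right_eq_zero] at hf'
    exact hf'
  refine ⟨α, eqToHom (hφ.obj_shift P α).symm ≫ φ.map g ≫ iM.hom, fun h => hg ?_⟩
  rw [Category.assoc, Preadditive.IsIso.comp_left_eq_zero, Category.assoc] at h
  apply φ.map_injective
  rw [Functor.map_comp, hf', Functor.map_zero, ← Category.assoc iM.hom, ← Category.assoc,
    h, Limits.zero_comp]

theorem IsGradedEquivalence.isEquivalence (h : IsGradedEquivalence φ) : φ.IsEquivalence := by
  obtain ⟨-, ψ, -, ⟨e⟩, ⟨e'⟩⟩ := h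
  exact (CategoryTheory.Equivalence.mk φ ψ e.symm e').isEquivalence_functor

theorem IsGradedEquivalence.exists_inverse (h : IsGradedEquivalence φ) :
    ∃ ψ : GrMod ℬ ⥤ GrMod 𝒜, IsGradedEquivalence ψ :=
  have ⟨hφ, ψ, hψ, u, c⟩ := h
  ⟨ψ, hψ, φ, hφ, c, u⟩

variable [GradedRing 𝒜] [GradedRing ℬ]

theorem IsGradedEquivalence.isSumRetract_obj_regular (h : IsGradedEquivalence φ) :
    IsSumRetract (fun α => (regular ℬ).shift α) (φ.obj (regular 𝒜)) := by
  obtain ⟨hφ, ψ, hψ, u, ⟨c⟩⟩ := h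
  have := hφ.1
  have : ψ.IsEquivalence := IsGradedEquivalence.isEquivalence ⟨hψ, φ, hφ, ⟨c⟩, u⟩
  exact (isGradedGenerator_regular.map hψ).isSumRetract_regular.map φ fun α =>
    eqToIso (hφ.obj_shift (ψ.obj (regular ℬ)) α) ≪≫ (suspension ℬ α).mapIso (c.app (regular ℬ))

theorem IsGradedEquivalence.isInvertibleBimodule (h : IsGradedEquivalence φ) :
    IsInvertibleBimodule A B h.1.bimod where
  bijective :=
    have := h.isEquivalence
    have := (hasDualBasis_of_isSumRetract h.isSumRetract_obj_regular).finite
    h.1.eltMap_bijective (regular 𝒜)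
  hasDualBasis := hasDualBasis_of_isSumRetract h.isSumRetract_obj_regular
  hasFullTrace :=
    have := h.isEquivalence
    (isGradedGenerator_regular.map h.1).hasFullTrace

theorem IsGradedEquivalence.isGradedProgenerator (h : IsGradedEquivalence φ) :
    IsGradedProgenerator (φ.obj (regular 𝒜)) :=
  isGradedProgenerator_of_isSumRetract h.isSumRetract_obj_regular
    h.isInvertibleBimodule.hasFullTrace

theorem IsGradedEquivalence.gradedIso_endGrading (h : IsGradedEquivalence φ) :
    GradedIso 𝒜 (endGrading (φ.obj (regular 𝒜))) := by
  have := h.isGradedProgenerator.1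
  let _ := (isInternal_homDeg (φ.obj (regular 𝒜)) (φ.obj (regular 𝒜))).chooseDecomposition
  have hmem γ a (ha : a ∈ 𝒜 γ) : h.1.leftAction a ∈ homDeg _ _ γ :=
    h.1.eltMap_mem (M := regular 𝒜) ha
  exact ⟨.ofBijective h.1.leftAction h.isInvertibleBimodule.bijective, fun γ a => ⟨hmem γ a,
    mem_of_map_mem (h.1.leftAction : A →+ Module.End Bᵐᵒᵖ (φ.obj (regular 𝒜)))
      Function.injective_id hmem h.isInvertibleBimodule.bijective.1⟩⟩

theorem IsGradedFunctor.nonempty_iso_grTensor (hφ : IsGradedFunctor φ) [φ.Full] [φ.Faithful]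
    (hQ : IsInvertibleBimodule A B hφ.bimod) : Nonempty (φ ≅ hφ.bimod.grTensor) := by
  have := hQ.hasDualBasis.finite
  have : Module.Finite Bᵐᵒᵖ (φ.obj (regular 𝒜)) := this
  let lin (M : GrMod 𝒜) : M →ₗ[Aᵐᵒᵖ] hφ.bimod.homObj (φ.obj M) :=
    { toFun := hφ.eltMap M
      map_add' := map_add (hφ.eltMap M)
      map_smul' := fun a m => hφ.eltMap_smul m a.unop }
  let elt : 𝟭 _ ≅ φ ⋙ hφ.bimod.grHom := NatIso.ofComponents
    (fun M => isoOfBijective (ofLin (N := hφ.bimod.homObj (φ.obj M)) (lin M)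
      fun _ _ hm => hφ.eltMap_mem hm) (hφ.eltMap_bijective M))
    fun f => hom_ext <| LinearMap.ext fun m => hφ.eltMap_natural f m
  exact ⟨φ.rightUnitor.symm ≪≫ Functor.isoWhiskerLeft φ (GrBimod.grCounitIso hQ).symm ≪≫
    (Functor.associator _ _ _).symm ≪≫ Functor.isoWhiskerRight elt.symm hφ.bimod.grTensor ≪≫
    Functor.leftUnitor _⟩

end GradedEquivalence

section ModuleEquivalence

open GrMod

variable {Γ : Type w} [AddCommGroup Γ] [DecidableEq Γ] {A B : Type u} [Ring A] [Ring B]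
  {𝒜 : Γ → AddSubgroup A} {ℬ : Γ → AddSubgroup B} {φ : GrMod 𝒜 ⥤ GrMod ℬ}
  {φ' : ModuleCat.{u} Aᵐᵒᵖ ⥤ ModuleCat.{u} Bᵐᵒᵖ}

/-- The elements of a graded module `M` as the morphisms `A ⟶ M` of `Mod-A`. -/
def eltAddEquiv [GradedRing 𝒜] (M : GrMod 𝒜) :
    M ≃+ (ModuleCat.of Aᵐᵒᵖ (regular 𝒜) ⟶ ModuleCat.of Aᵐᵒᵖ M) :=
  (eltLinEquiv (A := A) M).trans
    (ModuleCat.homAddEquiv (M := ModuleCat.of Aᵐᵒᵖ A) (N := ModuleCat.of Aᵐᵒᵖ M)).symm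

namespace IsAssociated

theorem obj_eq (h : IsAssociated φ φ') (M : GrMod 𝒜) :
    ModuleCat.of Bᵐᵒᵖ (φ.obj M) = φ'.obj (ModuleCat.of Aᵐᵒᵖ M) :=
  Functor.congr_obj h.2 M

theorem ofHom_mapDeg (h : IsAssociated φ φ') {M N : GrMod 𝒜} {γ : Γ} (f : homDeg M N γ) :
    ModuleCat.ofHom (h.1.mapDeg M N γ f)
      = eqToHom (h.obj_eq M) ≫ φ'.map (ModuleCat.ofHom f.1) ≫ eqToHom (h.obj_eq N).symm := by
  have hshift : (forgetGrading ℬ).map (h.1.mapShift (ofDeg f.1 f.2))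
      = eqToHom (h.obj_eq M) ≫ φ'.map (ModuleCat.ofHom f.1) ≫
        eqToHom ((h.obj_eq (N.shift γ)).symm.trans
          (congrArg (forgetGrading ℬ).obj (h.1.obj_shift N γ))) := by
    rw [IsGradedFunctor.mapShift, Functor.map_comp, eqToHom_map, ← Functor.comp_map,
      Functor.congr_hom h.2, Category.assoc, Category.assoc, eqToHom_trans]
    rfl
  exact hshift

variable [GradedRing 𝒜]

theorem ofHom_eltMap (h : IsAssociated φ φ') [φ'.Additive] (M : GrMod 𝒜) (m : M) :
    ModuleCat.ofHom (h.1.eltMap M m) = eqToHom (h.obj_eq (regular 𝒜)) ≫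
      φ'.map (eltAddEquiv M m) ≫ eqToHom (h.obj_eq M).symm := by
  induction m using DirectSum.Decomposition.inductionOn M.deg with
  | zero =>
    rw [map_zero, map_zero, ModuleCat.ofHom_zero, Functor.map_zero, Limits.zero_comp,
      Limits.comp_zero]
  | homogeneous m =>
    rw [h.1.eltMap_of_mem m.2]
    exact h.ofHom_mapDeg _
  | add m m' hm hm' =>
    rw [map_add, map_add, ModuleCat.ofHom_add, Functor.map_add, Preadditive.add_comp,
      Preadditive.comp_add, hm, hm']

theorem eltMap_bijective (h : IsAssociated φ φ') [φ'.Additive] [φ'.Full] [φ'.Faithful]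
    (M : GrMod 𝒜) : Function.Bijective (h.1.eltMap M) := by
  let conj := (eqToIso (h.obj_eq (regular 𝒜)).symm).homCongr (eqToIso (h.obj_eq M).symm)
  have hcomp : ModuleCat.homEquiv.symm ∘ h.1.eltMap M =
      conj ∘ φ'.map ∘ eltAddEquiv M :=
    funext (h.ofHom_eltMap M)
  have hbij := conj.bijective.comp <|
    (Functor.FullyFaithful.ofFullyFaithful φ').homEquiv.bijective.comp (eltAddEquiv M).bijective
  exact (Function.Bijective.of_comp_iff' ModuleCat.homEquiv.symm.bijective _).1 (hcomp ▸ hbij)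

theorem isInvertibleBimodule (h : IsAssociated φ φ') [φ'.Additive] [φ'.IsEquivalence] :
    IsInvertibleBimodule A B h.1.bimod where
  bijective := h.eltMap_bijective (regular 𝒜)
  hasDualBasis := (congrArg (fun X : ModuleCat.{u} Bᵐᵒᵖ => HasDualBasis B X)
    (h.obj_eq (regular 𝒜))).mpr (hasDualBasis_of_isEquivalence φ')
  hasFullTrace := (congrArg (fun X : ModuleCat.{u} Bᵐᵒᵖ => HasFullTrace B X)
    (h.obj_eq (regular 𝒜))).mpr (hasFullTrace_of_isEquivalence φ')

end IsAssociated

end ModuleEquivalence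

/-! ### Graded isomorphisms and corner rings -/

section Corners

variable {Γ R S T : Type*} [Ring R] [Ring S] [Ring T] {ℛ : Γ → AddSubgroup R}
  {𝒮 : Γ → AddSubgroup S} {𝒯 : Γ → AddSubgroup T}

theorem GradedIso.symm (h : GradedIso ℛ 𝒮) : GradedIso 𝒮 ℛ :=
  have ⟨f, hf⟩ := h
  ⟨f.symm, fun γ s => by rw [hf, f.apply_symm_apply]⟩

theorem GradedIso.trans (h : GradedIso ℛ 𝒮) (h' : GradedIso 𝒮 𝒯) : GradedIso ℛ 𝒯 :=
  have ⟨f, hf⟩ := h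
  have ⟨g, hg⟩ := h'
  ⟨f.trans g, fun γ r => (hf γ r).trans (hg γ (f r))⟩

theorem gradedIso_cornerGrading (f : S →ₙ+* R) (hf : Function.Injective f)
    (hdeg : ∀ γ s, s ∈ 𝒮 γ ↔ f s ∈ ℛ γ) {e : R} (he : IsIdempotentElem e) (hfe : f 1 = e)
    (hrange : ∀ r, ∃ s, f s = e * r * e) : GradedIso 𝒮 (cornerGrading ℛ he) := by
  subst hfe
  have hmem s : f s ∈ Subsemigroup.corner (f 1) :=
    (Subsemigroup.mem_corner_iff he).2
      ⟨by rw [← map_mul, one_mul], by rw [← map_mul, mul_one]⟩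
  let toCorner : S →+* he.Corner :=
    { toFun := fun s => ⟨f s, hmem s⟩
      map_one' := rfl
      map_mul' := fun s t => Subtype.ext (map_mul f s t)
      map_zero' := Subtype.ext (map_zero f)
      map_add' := fun s t => Subtype.ext (map_add f s t) }
  refine ⟨.ofBijective toCorner ⟨fun s t h => hf (congrArg Subtype.val h), ?_⟩, hdeg⟩
  rintro ⟨_, r, rfl⟩
  exact (hrange r).imp fun s hs => Subtype.ext hs

theorem isFull_iff_one_mem {e : R} :
    IsFull e ↔ (1 : R) ∈ AddSubgroup.closure {z : R | ∃ x y : R, z = x * e * y} := by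
  refine ⟨fun h => h ▸ AddSubgroup.mem_top _, fun h => (AddSubgroup.eq_top_iff' _).2 fun r => ?_⟩
  have hle : AddSubgroup.closure {z : R | ∃ x y : R, z = x * e * y} ≤
      (AddSubgroup.closure {z : R | ∃ x y : R, z = x * e * y}).comap (AddMonoidHom.mulRight r) := by
    rw [AddSubgroup.closure_le]
    rintro _ ⟨x, y, rfl⟩
    exact AddSubgroup.subset_closure ⟨x, y * r, mul_assoc _ _ _⟩
  simpa using hle h

theorem IsFull.map {e : R} (he : IsFull e) (f : R ≃+* S) : IsFull (f e) := by
  rw [isFull_iff_one_mem] at he ⊢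
  have hle : AddSubgroup.closure {z : R | ∃ x y : R, z = x * e * y} ≤
      (AddSubgroup.closure {z : S | ∃ x y : S, z = x * f e * y}).comap (f : R →+ S) := by
    rw [AddSubgroup.closure_le]
    rintro _ ⟨x, y, rfl⟩
    exact AddSubgroup.subset_closure ⟨f x, f y, by simp⟩
  simpa using hle he

end Corners

section FullTrace

variable {A : Type u} [Ring A] {P F : Type*} [AddCommGroup P] [Module Aᵐᵒᵖ P] [AddCommGroup F]
  [Module Aᵐᵒᵖ F] {i : P →ₗ[Aᵐᵒᵖ] F} {p : F →ₗ[Aᵐᵒᵖ] P}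

theorem HasFullTrace.of_one_mem_iSup (h : (1 : A) ∈ ⨆ θ : P →ₗ[Aᵐᵒᵖ] A, LinearMap.range θ) :
    HasFullTrace A P :=
  have ⟨n, θ, p, hp⟩ := exists_eq_sum_of_mem_iSup_range h
  ⟨n, p, θ, hp⟩

theorem HasFullTrace.isFull (hP : HasFullTrace A P) (hF : HasDualBasis A F)
    (hpi : p.comp i = LinearMap.id) : IsFull (i.comp p : Module.End Aᵐᵒᵖ F) := by
  obtain ⟨m, q, θ, hθ⟩ := hP
  obtain ⟨n, x, ξ, hx⟩ := hF
  have hsum : (1 : Module.End Aᵐᵒᵖ F) = ∑ j, ∑ k,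
      ((eltLin (x j)).comp ((θ k).comp p) : Module.End Aᵐᵒᵖ F) * i.comp p *
        i.comp ((eltLin (q k)).comp (ξ j)) := by
    refine LinearMap.ext fun v => ?_
    have hpi' q : p (i q) = q := LinearMap.congr_fun hpi q
    have hterm j k : (((eltLin (x j)).comp ((θ k).comp p) : Module.End Aᵐᵒᵖ F) * i.comp p *
        i.comp ((eltLin (q k)).comp (ξ j))) v = op (θ k (q k) * ξ j v) • x j := by
      change op (θ k (p (i (p (i (op (ξ j v) • q k)))))) • x j = _
      rw [hpi', hpi', map_smul, op_smul_eq_mul]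
    have hinner j : ∑ k, op (θ k (q k) * ξ j v) • x j = op (ξ j v) • x j := by
      rw [← Finset.sum_smul, ← Finset.op_sum, ← Finset.sum_mul, hθ, one_mul]
    simp only [LinearMap.sum_apply, hterm, hinner]
    exact (hx v).symm
  rw [isFull_iff_one_mem, hsum]
  exact sum_mem fun j _ => sum_mem fun k _ => AddSubgroup.subset_closure ⟨_, _, rfl⟩

theorem HasFullTrace.of_isFull (hF : HasFullTrace A F)
    (h : IsFull (i.comp p : Module.End Aᵐᵒᵖ F)) : HasFullTrace A P := by
  let trace : Submodule Aᵐᵒᵖ A := ⨆ θ : P →ₗ[Aᵐᵒᵖ] A, LinearMap.range θ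
  obtain ⟨n, v, ξ, hξ⟩ := hF
  refine .of_one_mem_iSup (hξ ▸ sum_mem fun k _ => ?_)
  let eval : Module.End Aᵐᵒᵖ F →+ A := AddMonoidHom.mk' (fun f => ξ k (f (v k))) fun f g => by simp
  have hle : AddSubgroup.closure {z | ∃ x y : Module.End Aᵐᵒᵖ F, z = x * i.comp p * y} ≤
      trace.toAddSubgroup.comap eval := by
    rw [AddSubgroup.closure_le]
    rintro _ ⟨x, y, rfl⟩
    exact Submodule.mem_iSup_of_mem ((ξ k).comp (x.comp i)) ⟨p (y (v k)), rfl⟩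
  exact hle (isFull_iff_one_mem.1 h)

end FullTrace

/-! ### Corners of matrix rings as graded endomorphism rings -/

section Matrices

open GrMod

variable {Γ : Type w} [AddCommGroup Γ] [DecidableEq Γ] {A : Type u} [Ring A]
  {𝒜 : Γ → AddSubgroup A}

theorem mem_homDeg_zero_of_isIdempotentElem {M : GrMod 𝒜} {e : Module.End Aᵐᵒᵖ M}
    (he : IsIdempotentElem e) {γ : Γ} (hγ : e ∈ homDeg M M γ) : e ∈ homDeg M M 0 := by
  intro β m hm
  by_cases hem : e m = 0
  · exact hem ▸ zero_mem _
  · have hee : e (e m) = e m := LinearMap.congr_fun he m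
    have hdeg := DirectSum.degree_eq_of_mem_mem M.deg (hγ β m hm)
      (hee ▸ hγ _ _ (hγ β m hm)) hem
    obtain rfl : γ = 0 := by simpa using hdeg
    exact hγ β m hm

variable [GradedRing 𝒜]

instance : IsIdempotentComplete (GrMod 𝒜) where
  idempotents_split M e he := by
    let P := ofSubmodule M (LinearMap.range (toLin e)) (isHomogeneous_range e)
    let i : P ⟶ M := ofLin (Submodule.subtype _) fun _ _ hm => hm
    let r : M ⟶ P := ofLin (N := P) (toLin e).rangeRestrict fun _ _ hm => toLin_mem e hm
    refine ⟨P, i, r, hom_ext <| LinearMap.ext ?_, rfl⟩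
    rintro ⟨_, m, rfl⟩
    exact Subtype.ext (LinearMap.congr_fun (congrArg toLin he) m)

theorem hasFullTrace_free {n : ℕ} (hn : 0 < n) (d : Fin n → Γ) : HasFullTrace A (free 𝒜 d) := by
  refine ⟨1, fun _ => Pi.single ⟨0, hn⟩ (1 : A), fun _ => LinearMap.proj ⟨0, hn⟩, ?_⟩
  exact (Fin.sum_univ_one _).trans (Pi.single_eq_same (M := fun _ : Fin n => A) ⟨0, hn⟩ 1)

/-- The endomorphisms of the graded free module on `n` generators as matrices over `A`, which act
on columns from the left. -/
def endFreeEquiv (𝒜 : Γ → AddSubgroup A) [GradedRing 𝒜] {n : ℕ} (d : Fin n → Γ) :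
    Module.End Aᵐᵒᵖ (free 𝒜 d) ≃+* Matrix (Fin n) (Fin n) A :=
  (endVecRingEquivMatrixEnd (Fin n) Aᵐᵒᵖ A).trans (RingEquiv.moduleEndSelfOp A).mapMatrix.symm

variable {n : ℕ} {d : Fin n → Γ}

theorem mem_endGrading_free_iff {γ : Γ} {f : Module.End Aᵐᵒᵖ (free 𝒜 d)} :
    f ∈ endGrading (free 𝒜 d) γ ↔ endFreeEquiv 𝒜 d f ∈ matrixGrading 𝒜 d γ := by
  obtain ⟨X, rfl⟩ := (endFreeEquiv 𝒜 d).symm.surjective f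
  rw [RingEquiv.apply_symm_apply]
  constructor
  · intro hX i j
    let b : Fin n → A := Pi.single j 1
    have hb : b ∈ (free 𝒜 d).deg (d j) :=
      (AddSubgroup.single_mem_pi (H := fun k => 𝒜 (d j - d k)) j 1).2 fun _ => by
        rw [sub_self]
        exact SetLike.one_mem_graded 𝒜
    have hcol : (endFreeEquiv 𝒜 d).symm X b i = X i j :=
      congrFun (Matrix.mulVec_single_one X j) i
    exact hcol ▸ add_comm γ (d j) ▸ hX (d j) b hb i trivial
  · intro hX β v hv i _
    refine sum_mem (B := AddSubgroup A) (fun j _ => ?_ : ∀ j ∈ Finset.univ, X i j * v j ∈ _)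
    have := SetLike.mul_mem_graded (hX i j) (hv j trivial)
    rwa [show γ + d j - d i + (β - d j) = β + γ - d i by abel] at this

end Matrices

section Corners

open GrMod

variable {Γ : Type w} [AddCommGroup Γ] [DecidableEq Γ] {A : Type u} [Ring A]
  {𝒜 : Γ → AddSubgroup A} {P F : GrMod 𝒜}

/-- Endomorphisms of a retract `P` of `F` as endomorphisms of `F`, by `f ↦ i f r`. The identity
goes to the idempotent `i r`. -/
def retractEnd (h : Retract P F) : Module.End Aᵐᵒᵖ P →ₙ+* Module.End Aᵐᵒᵖ F where
  toFun f := (toLin h.i).comp (f.comp (toLin h.r))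
  map_zero' := LinearMap.ext fun _ => map_zero (toLin h.i)
  map_add' _ _ := LinearMap.ext fun _ => map_add (toLin h.i) _ _
  map_mul' f g := LinearMap.ext fun v => congrArg (fun q => toLin h.i (f q))
    (LinearMap.congr_fun (congrArg toLin h.retract) (g (toLin h.r v))).symm

theorem comp_retractEnd_comp (h : Retract P F) (f : Module.End Aᵐᵒᵖ P) :
    (toLin h.r).comp ((retractEnd h f).comp (toLin h.i)) = f := by
  have hir q : toLin h.r (toLin h.i q) = q := LinearMap.congr_fun (congrArg toLin h.retract) q
  exact LinearMap.ext fun q => (hir _).trans (congrArg f (hir q))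

theorem retractEnd_injective (h : Retract P F) : Function.Injective (retractEnd h) := fun f g hfg =>
  by rw [← comp_retractEnd_comp h f, hfg, comp_retractEnd_comp h g]

theorem mem_endGrading_iff_retractEnd (h : Retract P F) {γ : Γ} {f : Module.End Aᵐᵒᵖ P} :
    f ∈ endGrading P γ ↔ retractEnd h f ∈ endGrading F γ :=
  ⟨fun hf β _ hv => toLin_mem h.i (hf β _ (toLin_mem h.r hv)), fun hf β q hq =>
    LinearMap.congr_fun (comp_retractEnd_comp h f) q ▸ toLin_mem h.r (hf β _ (toLin_mem h.i hq))⟩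

theorem gradedIso_cornerGrading_of_retract [GradedRing 𝒜] {n : ℕ} {d : Fin n → Γ}
    (h : Retract P (free 𝒜 d)) {e : Matrix (Fin n) (Fin n) A} (he : IsIdempotentElem e)
    (hre : endFreeEquiv 𝒜 d (toLin (h.r ≫ h.i)) = e) :
    GradedIso (endGrading P) (cornerGrading (matrixGrading 𝒜 d) he) := by
  refine gradedIso_cornerGrading ((endFreeEquiv 𝒜 d : _ →ₙ+* _).comp (retractEnd h))
    ((endFreeEquiv 𝒜 d).injective.comp (retractEnd_injective h))
    (fun γ f => (mem_endGrading_iff_retractEnd h).trans mem_endGrading_free_iff) he hre fun X => ?_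
  obtain ⟨f, rfl⟩ := (endFreeEquiv 𝒜 d).surjective X
  refine ⟨(toLin h.r).comp (f.comp (toLin h.i)), ?_⟩
  rw [← hre, ← map_mul, ← map_mul]
  rfl

end Corners

section Progenerators

open GrMod

variable {Γ : Type w} [AddCommGroup Γ] [DecidableEq Γ] {A B : Type u} [Ring A] [Ring B]
  {𝒜 : Γ → AddSubgroup A} {ℬ : Γ → AddSubgroup B} [GradedRing 𝒜]

theorem IsGradedProgenerator.exists_gradedIso_cornerGrading {P : GrMod 𝒜}
    (hP : IsGradedProgenerator P) :
    ∃ (n : ℕ) (_ : 0 < n) (d : Fin n → Γ) (e : Matrix (Fin n) (Fin n) A)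
      (he : IsIdempotentElem e), IsFull e ∧ e ∈ matrixGrading 𝒜 d 0 ∧
        GradedIso (endGrading P) (cornerGrading (matrixGrading 𝒜 d) he) := by
  have := hP.1
  have := hP.2.1
  obtain ⟨n, hn, d, ⟨h⟩⟩ := P.exists_retract_free
  have he : IsIdempotentElem (toLin (h.r ≫ h.i) : Module.End Aᵐᵒᵖ (free 𝒜 d)) :=
    congrArg toLin (show (h.r ≫ h.i) ≫ h.r ≫ h.i = h.r ≫ h.i by simp)
  have hfull : IsFull (toLin (h.r ≫ h.i) : Module.End Aᵐᵒᵖ (free 𝒜 d)) :=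
    hP.2.2.hasFullTrace.isFull (hasDualBasis_of_isSumRetract (isSumRetract_free d))
      (congrArg toLin h.retract)
  exact ⟨n, hn, d, _, he.map (endFreeEquiv 𝒜 d), hfull.map (endFreeEquiv 𝒜 d),
    mem_endGrading_free_iff.1 (h.r ≫ h.i).2, gradedIso_cornerGrading_of_retract h _ rfl⟩

theorem exists_isGradedProgenerator_gradedIso_cornerGrading {n : ℕ} (hn : 0 < n) {d : Fin n → Γ}
    {e : Matrix (Fin n) (Fin n) A} (he : IsIdempotentElem e) (hfull : IsFull e) {γ : Γ}
    (hγ : e ∈ matrixGrading 𝒜 d γ) :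
    ∃ P : GrMod 𝒜, IsGradedProgenerator P ∧
      GradedIso (endGrading P) (cornerGrading (matrixGrading 𝒜 d) he) := by
  obtain ⟨f, rfl⟩ := (endFreeEquiv 𝒜 d).surjective e
  have hf : IsIdempotentElem f := (endFreeEquiv 𝒜 d).injective ((map_mul _ _ _).trans he)
  let f₀ : free 𝒜 d ⟶ free 𝒜 d :=
    ⟨f, mem_homDeg_zero_of_isIdempotentElem hf (mem_endGrading_free_iff.2 hγ)⟩
  obtain ⟨P, i, r, hir, hri⟩ := IsIdempotentComplete.idempotents_split _ f₀ (hom_ext hf)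
  let h : Retract P (free 𝒜 d) := ⟨i, r, hir⟩
  have hfull' : IsFull ((toLin i).comp (toLin r) : Module.End Aᵐᵒᵖ (free 𝒜 d)) := by
    have hri' : (toLin i).comp (toLin r) = f := congrArg toLin hri
    rw [hri', ← (endFreeEquiv 𝒜 d).symm_apply_apply f]
    exact hfull.map (endFreeEquiv 𝒜 d).symm
  exact ⟨P, isGradedProgenerator_of_isSumRetract ((isSumRetract_free d).of_retract h)
    ((hasFullTrace_free hn d).of_isFull hfull'),
    gradedIso_cornerGrading_of_retract h he (congrArg (fun g => endFreeEquiv 𝒜 d (toLin g)) hri)⟩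

theorem IsGradedProgenerator.exists_isGradedEquivalence [GradedRing ℬ] {P : GrMod 𝒜}
    (hP : IsGradedProgenerator P) (h : GradedIso ℬ (endGrading P)) :
    ∃ φ : GrMod 𝒜 ⥤ GrMod ℬ, IsGradedEquivalence φ := by
  obtain ⟨f, hf⟩ := h
  have := hP.1
  have := hP.2.1
  let Q : GrBimod ℬ 𝒜 := .ofEnd P (f : B →+* Module.End Aᵐᵒᵖ P) fun β b hb => (hf β b).1 hb
  have hQ : IsInvertibleBimodule B A Q :=
    ⟨f.bijective, hasDualBasis_of_isSumRetract (isSumRetract_shift_regular P),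
      hP.2.2.hasFullTrace⟩
  exact IsGradedEquivalence.exists_inverse (GrBimod.isGradedEquivalence_grTensor hQ)

end Progenerators

end GradedMorita

open GradedMorita in
theorem mainTheorem6 {Γ : Type w} [AddCommGroup Γ] [DecidableEq Γ] {A B : Type u} [Ring A] [Ring B]
    (𝒜 : Γ → AddSubgroup A) (ℬ : Γ → AddSubgroup B) [GradedRing 𝒜] [GradedRing ℬ] :
    [∃ φ' : ModuleCat.{u} Aᵐᵒᵖ ⥤ ModuleCat.{u} Bᵐᵒᵖ, IsGradedModEquivalence 𝒜 ℬ φ',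
      ∃ φ : GrMod 𝒜 ⥤ GrMod ℬ, IsGradedEquivalence φ,
      ∃ P : GrMod 𝒜, IsGradedProgenerator P ∧ GradedIso ℬ (endGrading P),
      ∃ (n : ℕ) (_ : 0 < n) (δ : Fin n → Γ) (e : Matrix (Fin n) (Fin n) A)
        (he : IsIdempotentElem e), IsFull e ∧ (∃ γ : Γ, e ∈ matrixGrading 𝒜 δ γ) ∧
          GradedIso ℬ (cornerGrading (matrixGrading 𝒜 δ) he)].TFAE ∧
    ∀ φ : GrMod 𝒜 ⥤ GrMod ℬ, IsGradedEquivalence φ →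
      (∃ (φ' : ModuleCat.{u} Aᵐᵒᵖ ⥤ ModuleCat.{u} Bᵐᵒᵖ) (φ₁ : GrMod 𝒜 ⥤ GrMod ℬ),
        IsGradedModEquivalence 𝒜 ℬ φ' ∧ IsAssociated φ₁ φ' ∧ Nonempty (φ₁ ≅ φ)) ∧
      ∃ Q : GrBimod 𝒜 ℬ, Nonempty (φ ≅ Q.grTensor) ∧ IsAssociated Q.grTensor Q.tensor ∧
        IsGradedModEquivalence 𝒜 ℬ Q.tensor := by
  constructor
  · tfae_have 1 → 2 := fun ⟨_, _, _, _, h⟩ =>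
      ⟨_, GrBimod.isGradedEquivalence_grTensor h.isInvertibleBimodule⟩
    tfae_have 2 → 1 := fun ⟨_, h⟩ =>
      ⟨_, GrBimod.isGradedModEquivalence_tensor h.isInvertibleBimodule⟩
    tfae_have 2 → 3 := fun ⟨_, h⟩ =>
      have ⟨ψ, hψ⟩ := IsGradedEquivalence.exists_inverse h
      ⟨_, hψ.isGradedProgenerator, hψ.gradedIso_endGrading⟩
    tfae_have 3 → 2 := fun ⟨_, hP, h⟩ => hP.exists_isGradedEquivalence h
    tfae_have 3 → 4 := fun ⟨_, hP, h⟩ =>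
      have ⟨n, hn, d, e, he, hfull, hdeg, hiso⟩ := hP.exists_gradedIso_cornerGrading
      ⟨n, hn, d, e, he, hfull, ⟨0, hdeg⟩, h.trans hiso⟩
    tfae_have 4 → 3 := fun ⟨_, hn, _, _, he, hfull, ⟨_, hdeg⟩, h⟩ =>
      have ⟨P, hP, hiso⟩ := exists_isGradedProgenerator_gradedIso_cornerGrading hn he hfull hdeg
      ⟨P, hP, h.trans hiso.symm⟩
    tfae_finish
  · intro φ h
    have := h.isEquivalence
    have hQ := h.isInvertibleBimodule
    obtain ⟨e⟩ := h.1.nonempty_iso_grTensor hQ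
    have hmod := GrBimod.isGradedModEquivalence_tensor hQ
    exact ⟨⟨_, _, hmod, GrBimod.isAssociated _, ⟨e.symm⟩⟩, _, ⟨e⟩, GrBimod.isAssociated _, hmod⟩
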